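/- For $A\subseteq\mathbb Z$ write $A-A=\{a-b : a,b\in A\}$ and let $\bar d(A)=\limsup_{n\to\infty}\frac{|A\cap\{1,\dots,n\}|}{n}$ be its upper asymptotic density. A set $S\subseteq\mathbb Z$ is called chromatically recurrent if for every partition $\{A_1,\dots,A_r\}$ of $\mathbb Z$ into finitely many sets there is $j$ with $(A_j-A_j)\cap S\neq\varnothing$; density recurrent if $(A-A)\cap S\neq\varnothing$ for every $A\subseteq\mathbb Z$ with $\bar d(A)>0$; a set of topological recurrence if for every minimal homeomorphism $T$ of a compact metrizable space $X$ (one for which every orbit $\{T^nx:n\in\mathbb Z\}$ is dense) and every nonempty open $U\subseteq X$ there is $n\in S$ with $U\cap T^{-n}U\neq\varnothing$; and a set of measurable recurrence if for every invertible probability measure preserving system $(X,\mu,T)$ and every measurable $B\subseteq X$ with $\mu(B)>0$ there is $n\in S$ with $\mu(B\cap T^{-n}B)>0$. Theorem. For every infinite set $E\subseteq\mathbb Z$ there is a set $S\subseteq E-E$ which is chromatically recurrent and not density recurrent. Moreover, this $S$ is a set of topological recurrence and not a set of measurable recurrence. -/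

import Mathlib

open scoped Pointwise

/-- The upper asymptotic density `limsup_{n → ∞} |A ∩ {1, …, n}| / n` of a set of integers
(the quotients lie in `[0, 1]`). -/
noncomputable def upperDensity (A : Set ℤ) : ℝ :=
  Filter.limsup (fun n : ℕ => ((A ∩ Set.Icc 1 (n : ℤ)).ncard : ℝ) / (n : ℝ)) Filter.atTop

/-- `S` is density recurrent: `(A - A) ∩ S ≠ ∅` for every `A ⊆ ℤ` of positive upper density. -/
def IsDensityRecurrent (S : Set ℤ) : Prop :=
  ∀ A : Set ℤ, 0 < upperDensity A → ((A - A) ∩ S).Nonempty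

/-- `S` is chromatically recurrent: in every partition of `ℤ` into finitely many sets there is a
cell `A j` with `(A j - A j) ∩ S ≠ ∅`. (Empty cells are allowed; they are irrelevant.) -/
def IsChromaticallyRecurrent (S : Set ℤ) : Prop :=
  ∀ (r : ℕ) (A : Fin r → Set ℤ), Pairwise (fun i j => Disjoint (A i) (A j)) →
    (⋃ j, A j) = Set.univ → ∃ j, ((A j - A j) ∩ S).Nonempty

/-- `S` is a set of topological recurrence: for every minimal homeomorphism `T` of a compact
metrizable space `X` (every orbit is dense) and every nonempty open `U ⊆ X` there is `n ∈ S` with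
`U ∩ T⁻ⁿ U ≠ ∅`. (A compact metrizable space has at most the cardinality of the continuum, so
`Type` contains all of them up to homeomorphism.) -/
def IsTopologicallyRecurrent (S : Set ℤ) : Prop :=
  ∀ (X : Type) [TopologicalSpace X] [CompactSpace X] [TopologicalSpace.MetrizableSpace X]
    (T : X ≃ₜ X), (∀ x : X, Dense (Set.range fun n : ℤ => (T ^ n) x)) →
    ∀ U : Set X, IsOpen U → U.Nonempty → ∃ n ∈ S, (U ∩ ⇑(T ^ n) ⁻¹' U).Nonempty

/-- `S` is a set of measurable recurrence: for every invertible probability measure preserving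
system `(X, μ, T)` and every measurable `B ⊆ X` with `μ B > 0` there is `n ∈ S` with
`μ (B ∩ T⁻ⁿ B) > 0`. -/
def IsMeasurablyRecurrent (S : Set ℤ) : Prop :=
  ∀ (X : Type) [MeasurableSpace X] (μ : MeasureTheory.Measure X)
    [MeasureTheory.IsProbabilityMeasure μ] (T : X ≃ᵐ X), MeasureTheory.MeasurePreserving T μ μ →
    ∀ B : Set X, MeasurableSet B → 0 < μ B → ∃ n ∈ S, 
      0 < μ (B ∩ ⇑((T.toEquiv : Equiv.Perm X) ^ n) ⁻¹' B)

/-! Fix `r` and put n = 2k + r. Attach to each k-subset v of an n-set an element e(v) of `E`. By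
Lovász–Kneser (`exists_disjoint_same_colour`, deduced from Tucker's lemma), every r-colouring of the
integers gives e(v) and e(w) the same colour for some disjoint v, w, so the finitely many
differences e(v) - e(w) over disjoint pairs are recurrent for r colours.

A large set can nevertheless avoid them. If the e(v) are chosen suitably sparse
(`exists_simultaneous_approx`), there are tiny α_1, …, α_n such that e(v)α_i is near 1/2 modulo 1
for i in v and near 0 otherwise. Rotating an n-torus by (α_i) for time e(v) - e(w) moves every
coordinate in v ∪ w by about half a turn and leaves only r coordinates uncontrolled. Give a point
the sign + or - when more than (n + r)/2 of its coordinates lie in one or the other of two opposite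
arcs, and 0 otherwise. No nonzero sign survives such a move, yet most points have a sign, because
for large k few subsets of an n-set have nearly n/2 elements. `exists_kneser_rotation` carries this
out on a finite torus.

To treat all r at once, systems are multiplied (`HasSignSystem.extend`): the new factor hardly moves
at the old times, as its α_i are tiny, and the old factor is the identity at the new times, as the
new e(v) share a residue class modulo its order. The losses of density sum to at most 1/2. A weak
limit then yields one measure preserving system with a set of measure at least 1/4 that does not
return at any time in `S`, so measurable recurrence fails. Density recurrence would imply it, so
that fails too. Recurrence for all finite colourings gives the two positive claims. -/

/-! ### Ky Fan's parity theorem and Tucker's lemma -/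

/-- Sign reversal of a label `(j, t)`, thought of as `±j`. -/
def flipLabel (l : ℕ × Bool) : ℕ × Bool := (l.1, !l.2)

/-- The indicator (mod 2) that a multiset of labels, given by its multiplicities `s`, has at most
one label of each absolute value below `m`, and that their signs, read from the largest absolute
value downwards, alternate and start with `b`. -/
def altSign : ℕ → Bool → (ℕ × Bool → ℕ) → ZMod 2
  | 0, _, _ => 1
  | m + 1, b, s =>
    if s (m, b) = 0 ∧ s (m, !b) = 0 then altSign m b s
    else if s (m, b) = 1 ∧ s (m, !b) = 0 then altSign m (!b) s else 0

/-- The coboundary of a functional on multisets of labels. -/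
def labelCoboundary (m : ℕ) (f : (ℕ × Bool → ℕ) → ZMod 2) (s : ℕ × Bool → ℕ) : ZMod 2 :=
  ∑ j ∈ Finset.range m, ∑ t : Bool, (s (j, t) : ZMod 2) * f (s - Pi.single (j, t) 1)

theorem altSign_congr {m : ℕ} {b : Bool} {s s' : ℕ × Bool → ℕ}
    (h : ∀ j < m, ∀ t, s (j, t) = s' (j, t)) : altSign m b s = altSign m b s' := by
  induction m generalizing b with
  | zero => rfl
  | succ m ih =>
    have h1 : ∀ b, altSign m b s = altSign m b s' := fun b => ih fun j hj t => h j (by omega) t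
    simp only [altSign, h m (Nat.lt_succ_self m), h1]

theorem altSign_flip (m : ℕ) (b : Bool) (s : ℕ × Bool → ℕ) :
    altSign m (!b) (fun l => s (flipLabel l)) = altSign m b s := by
  induction m generalizing b with
  | zero => rfl
  | succ m ih =>
    have := ih (!b)
    simp only [altSign, flipLabel, Bool.not_not] at *
    simp only [ih, this]

theorem altSign_sum_le {m : ℕ} {b : Bool} {s : ℕ × Bool → ℕ} (h : altSign m b s ≠ 0) :
    ∑ j ∈ Finset.range m, ∑ t : Bool, s (j, t) ≤ m := by
  induction m generalizing b with
  | zero => simp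
  | succ m ih =>
    rw [Finset.sum_range_succ]
    have hs : ∑ t : Bool, s (m, t) = s (m, b) + s (m, !b) := by
      cases b <;> simp [add_comm]
    rw [hs]
    rw [altSign] at h
    split_ifs at h with h1 h2
    · have := ih h; omega
    · have := ih h; omega
    · exact absurd rfl h

/-- The left side counts the deletions of one label that leave an alternating sequence starting with
`b`. From a nonempty alternating sequence exactly one works: the last label or the first, according
to the starting sign. Otherwise the good deletions come in pairs, as two neighbours of equal sign
can replace each other. -/
theorem labelCoboundary_altSign {m : ℕ} {s : ℕ × Bool → ℕ}
    (hs : ∀ j < m, s (j, true) = 0 ∨ s (j, false) = 0) (b : Bool) :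
    labelCoboundary m (altSign m b) s = altSign m b s + altSign m (!b) s := by
  induction m generalizing b with
  | zero => simp only [labelCoboundary, altSign, Finset.range_zero, Finset.sum_empty]; decide
  | succ m ih =>
    have ih' := ih (fun j hj => hs j (by omega))
    have key : ∀ j ∈ Finset.range m, ∀ t t', (s - Pi.single (j, t) 1 : ℕ × Bool → ℕ) (m, t')
        = s (m, t') := by
      intro j hj t t'
      have : (m, t') ≠ (j, t) := by
        intro h; simp at hj; have := congrArg Prod.fst h; simp at this; omega
      simp [Pi.single_eq_of_ne this]
    have low : ∀ t b, altSign m b (s - Pi.single (m, t) 1) = altSign m b s := by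
      intro t b
      apply altSign_congr
      intro j hj t'
      have : (j, t') ≠ (m, t) := by
        intro h; have := congrArg Prod.fst h; simp at this; omega
      simp [Pi.single_eq_of_ne this]
    have e1 : labelCoboundary (m + 1) (altSign (m + 1) b) s =
        (if s (m, b) = 0 ∧ s (m, !b) = 0 then labelCoboundary m (altSign m b) s
          else if s (m, b) = 1 ∧ s (m, !b) = 0 then labelCoboundary m (altSign m (!b)) s else 0)
        + ((s (m, b) : ZMod 2) * altSign (m + 1) b (s - Pi.single (m, b) 1)
          + (s (m, !b) : ZMod 2) * altSign (m + 1) b (s - Pi.single (m, !b) 1)) := by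
      rw [labelCoboundary, Finset.sum_range_succ]
      congr 1
      · split_ifs with h1 h2
        · refine Finset.sum_congr rfl fun j hj => Finset.sum_congr rfl fun t _ => ?_
          rw [altSign, key j hj, key j hj, if_pos h1]
        · refine Finset.sum_congr rfl fun j hj => Finset.sum_congr rfl fun t _ => ?_
          rw [altSign, key j hj, key j hj, if_neg h1, if_pos h2]
        · refine Finset.sum_eq_zero fun j hj => Finset.sum_eq_zero fun t _ => ?_
          rw [altSign, key j hj, key j hj, if_neg h1, if_neg h2, mul_zero]
      · cases b <;> simp [add_comm]
    have hb : s (m, b) = 0 ∨ s (m, !b) = 0 := by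
      rcases hs m (Nat.lt_succ_self m) with h | h <;> cases b <;> simp [h]
    have v1 : ∀ t, (s - Pi.single (m, t) 1 : ℕ × Bool → ℕ) (m, t) = s (m, t) - 1 := by
      intro t; simp
    have v2 : ∀ t, (s - Pi.single (m, t) 1 : ℕ × Bool → ℕ) (m, !t) = s (m, !t) := by
      intro t
      simp
    have v3 : ∀ t, (s - Pi.single (m, !t) 1 : ℕ × Bool → ℕ) (m, t) = s (m, t) := by
      intro t
      simp
    have two : ((2 : ℕ) : ZMod 2) = 0 := by decide
    have aa : ∀ x : ZMod 2, x + x = 0 := CharTwo.add_self_eq_zero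
    rw [e1, ih' b, ih' (!b)]
    simp only [altSign, v1, v2, v3, low, Bool.not_not]
    -- Only one sign can occur at the top absolute value. If it occurs twice, its two deletions
    -- cancel modulo 2; if more often, no single deletion leaves an alternating sequence.
    rcases hb with h0 | h0 <;> rw [h0]
    · rcases Nat.lt_trichotomy (s (m, !b)) 1 with h | h | h
      · have : s (m, !b) = 0 := by omega
        simp [this]
      · simp [h]
      · rcases eq_or_ne (s (m, !b)) 2 with h2 | h2
        · simp [h2]
        · have : s (m, !b) ≠ 0 := by omega
          have : s (m, !b) ≠ 1 := by omega
          have : s (m, !b) - 1 ≠ 0 := by omega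
          simp [*]
    · rcases Nat.lt_trichotomy (s (m, b)) 1 with h | h | h
      · have : s (m, b) = 0 := by omega
        simp [this]
      · simp [h]
        linear_combination aa (altSign m b s)
      · rcases eq_or_ne (s (m, b)) 2 with h2 | h2
        · simpa [h2] using Or.inl two
        · have : s (m, b) ≠ 0 := by omega
          have : s (m, b) ≠ 1 := by omega
          have : s (m, b) - 1 ≠ 0 := by omega
          have : s (m, b) - 1 ≠ 1 := by omega
          simp [*]

/-- For a labelling `lam P U` of the faces of the cross-polytope (`U` is the support of the face,
`P` contains its positive coordinates) this is the sum of `f`, evaluated at `s` plus the labels of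
the flag, over all flags of length `k` that end at the face `(P, U)`. -/
def flagSum (lam : Finset ℕ → Finset ℕ → ℕ × Bool) (f : (ℕ × Bool → ℕ) → ZMod 2)
    (P : Finset ℕ) : ℕ → Finset ℕ → (ℕ × Bool → ℕ) → ZMod 2
  | 0, _, s => f s
  | k + 1, U, s => ∑ i ∈ U, flagSum lam f P k (U.erase i) (s + Pi.single (lam P U) 1)

theorem labelCoboundary_add_single {m : ℕ} (f : (ℕ × Bool → ℕ) → ZMod 2) (s : ℕ × Bool → ℕ)
    {l : ℕ × Bool} (hl : l.1 < m) :
    labelCoboundary m f (s + Pi.single l 1) =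
      f s + labelCoboundary m (fun s => f (s + Pi.single l 1)) s := by
  have hf : f s = ∑ j ∈ Finset.range m, ∑ t : Bool,
      ((Pi.single l 1 : ℕ × Bool → ℕ) (j, t) : ZMod 2) * f s := by
    rw [← Finset.sum_product' (Finset.range m) Finset.univ
      (fun j t => ((Pi.single l 1 : ℕ × Bool → ℕ) (j, t) : ZMod 2) * f s),
      Finset.sum_eq_single l]
    · simp
    · intro b _ hb
      simp [Pi.single_eq_of_ne hb]
    · intro h; simp at h; omega
  rw [hf]
  simp only [labelCoboundary]
  rw [← Finset.sum_add_distrib]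
  refine Finset.sum_congr rfl fun j hj => ?_
  rw [← Finset.sum_add_distrib]
  refine Finset.sum_congr rfl fun t _ => ?_
  by_cases hjt : (j, t) = l
  · subst hjt
    have e : s + Pi.single (j, t) 1 - Pi.single (j, t) 1 = s := by ext; simp
    rw [e]
    by_cases h0 : s (j, t) = 0
    · simp [h0]
    · have e2 : s - Pi.single (j, t) 1 + Pi.single (j, t) 1 = s := by
        ext x
        by_cases hx : x = (j, t)
        · subst hx; simp; omega
        · simp [Pi.single_eq_of_ne hx]
      rw [e2]; simp; ring
  · by_cases h0 : s (j, t) = 0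
    · simp [h0, Pi.single_eq_of_ne hjt]
    · have e2 : s + Pi.single l 1 - Pi.single (j, t) 1 = s - Pi.single (j, t) 1 + Pi.single l 1 := by
        ext x
        by_cases hx : x = (j, t)
        · subst hx; simp [Pi.single_eq_of_ne hjt]
        · simp [Pi.single_eq_of_ne hx]
      rw [e2]; simp [Pi.single_eq_of_ne hjt]

theorem labelCoboundary_sum {m : ℕ} (V : Finset ℕ) (g : ℕ → (ℕ × Bool → ℕ) → ZMod 2)
    (s : ℕ × Bool → ℕ) :
    ∑ i ∈ V, labelCoboundary m (g i) s = labelCoboundary m (fun s => ∑ i ∈ V, g i s) s := by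
  simp only [labelCoboundary, Finset.mul_sum]
  rw [Finset.sum_comm]
  refine Finset.sum_congr rfl fun j _ => ?_
  rw [Finset.sum_comm]

/-- Removing i and then j gives the same set as removing j and then i. This is the "boundary of a
boundary is zero" of the proof. -/
theorem sum_sum_erase_eq_zero (U : Finset ℕ) (h : Finset ℕ → ZMod 2) :
    ∑ i ∈ U, ∑ j ∈ U.erase i, h ((U.erase i).erase j) = 0 := by
  rw [Finset.sum_sigma']
  refine Finset.sum_involution (fun x _ => ⟨x.2, x.1⟩) ?_ ?_ ?_ ?_
  · rintro ⟨i, j⟩ _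
    simp only
    rw [Finset.erase_right_comm]
    exact CharTwo.add_self_eq_zero _
  · rintro ⟨i, j⟩ hx _ he
    simp only [Finset.mem_sigma, Finset.mem_erase] at hx
    exact hx.2.1 (by simpa using congrArg Sigma.fst he)
  · rintro ⟨i, j⟩ hx
    simp only [Finset.mem_sigma, Finset.mem_erase] at hx ⊢
    exact ⟨hx.2.2, fun h => hx.2.1 h.symm, hx.1⟩
  · rintro ⟨i, j⟩ _; rfl

section Labelling

variable {lam : Finset ℕ → Finset ℕ → ℕ × Bool} {m : ℕ} {W : Finset ℕ}

theorem flagSum_erase_erase (f : (ℕ × Bool → ℕ) → ZMod 2) (P : Finset ℕ) (k : ℕ) (U : Finset ℕ)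
    (s : ℕ × Bool → ℕ) :
    ∑ i ∈ U, ∑ j ∈ U.erase i, flagSum lam f P k ((U.erase i).erase j) s = 0 :=
  sum_sum_erase_eq_zero U (fun V => flagSum lam f P k V s)

/-- Deleting a label of a flag means deleting a face from it. Below the top, a deleted face can be
replaced by exactly one other, so these terms cancel in pairs; what remains is the deletion of the
top face and the deletions from `s`. -/
theorem flagSum_labelCoboundary (hm : ∀ P U, U ⊆ W → U.Nonempty → (lam P U).1 < m)
    (f : (ℕ × Bool → ℕ) → ZMod 2) (P : Finset ℕ) (k : ℕ) (U : Finset ℕ) (hU : U ⊆ W)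
    (hk : U.card = k + 1) (s : ℕ × Bool → ℕ) :
    flagSum lam (labelCoboundary m f) P (k + 1) U s =
      labelCoboundary m (flagSum lam f P (k + 1) U) s +
        ∑ i ∈ U, flagSum lam f P k (U.erase i) s := by
  induction k generalizing U s with
  | zero =>
    have hl : (lam P U).1 < m := hm P U hU (Finset.card_pos.1 (by omega))
    simp only [flagSum]
    have hsum := labelCoboundary_sum (m := m) U (fun _ s => f (s + Pi.single (lam P U) 1)) s
    rw [← hsum, ← Finset.sum_add_distrib]
    refine Finset.sum_congr rfl fun i _ => ?_
    rw [labelCoboundary_add_single f s hl, add_comm]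
  | succ k ih =>
    have hl : (lam P U).1 < m := hm P U hU (Finset.card_pos.1 (by omega))
    have hs : ∀ i ∈ U, flagSum lam (labelCoboundary m f) P (k + 1) (U.erase i)
        (s + Pi.single (lam P U) 1) = labelCoboundary m
          (fun s => flagSum lam f P (k + 1) (U.erase i) (s + Pi.single (lam P U) 1)) s
          + flagSum lam f P (k + 1) (U.erase i) s
          + ∑ j ∈ U.erase i, flagSum lam f P k ((U.erase i).erase j)
              (s + Pi.single (lam P U) 1) := by
      intro i hi
      have hc : (U.erase i).card = k + 1 := by rw [Finset.card_erase_of_mem hi]; omega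
      have hsub := (Finset.erase_subset i U).trans hU
      rw [ih (U.erase i) hsub hc, labelCoboundary_add_single _ s hl]
      ring
    have h0 := flagSum_erase_erase (lam := lam) f P k U (s + Pi.single (lam P U) 1)
    rw [flagSum, Finset.sum_congr rfl hs, Finset.sum_add_distrib, Finset.sum_add_distrib, h0,
      add_zero]
    have hsum := labelCoboundary_sum (m := m) U
      (fun i s => flagSum lam f P (k + 1) (U.erase i) (s + Pi.single (lam P U) 1)) s
    rw [hsum]
    rfl

theorem flagSum_face (hm : ∀ P U, U ⊆ W → U.Nonempty → (lam P U).1 < m)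
    (f : (ℕ × Bool → ℕ) → ZMod 2) (P : Finset ℕ) (k : ℕ) (U : Finset ℕ) (hU : U ⊆ W)
    (hk : U.card = k + 1) :
    flagSum lam (labelCoboundary m f) P (k + 1) U 0 =
      ∑ i ∈ U, flagSum lam f P k (U.erase i) 0 := by
  rw [flagSum_labelCoboundary hm f P k U hU hk 0]
  simp [labelCoboundary]

/-- Along a flag no two labels are opposite, so only the values on multisets without opposite labels
matter. This admits `labelCoboundary_altSign` under the sum. -/
theorem flagSum_congr_left {f g : (ℕ × Bool → ℕ) → ZMod 2}
    (hfg : ∀ s, (∀ j, s (j, true) = 0 ∨ s (j, false) = 0) → f s = g s)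
    (P : Finset ℕ)
    (hc : ∀ U V, U.Nonempty → U ⊆ V → V ⊆ W → lam P U ≠ flipLabel (lam P V))
    (k : ℕ) (U : Finset ℕ) (hU : U ⊆ W) (s : ℕ × Bool → ℕ)
    (h1 : ∀ l, s l ≠ 0 → ∃ V, U ⊆ V ∧ V ⊆ W ∧ lam P V = l)
    (h2 : ∀ j, s (j, true) = 0 ∨ s (j, false) = 0) :
    flagSum lam f P k U s = flagSum lam g P k U s := by
  induction k generalizing U s with
  | zero => exact hfg s h2
  | succ k ih =>
    refine Finset.sum_congr rfl fun i hi => ?_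
    have hne : s (flipLabel (lam P U)) = 0 := by
      by_contra h
      obtain ⟨V, hV, hVW, hVl⟩ := h1 _ h
      exact hc U V ⟨i, hi⟩ hV hVW (by rw [hVl]; simp [flipLabel])
    refine ih (U.erase i) ((Finset.erase_subset i U).trans hU) _ ?_ ?_
    · intro l hl
      by_cases h : l = lam P U
      · exact ⟨U, Finset.erase_subset _ _, hU, h.symm⟩
      · have : s l ≠ 0 := by simpa [Pi.single_eq_of_ne h] using hl
        obtain ⟨V, hV, hVW, hVl⟩ := h1 l this
        exact ⟨V, (Finset.erase_subset _ _).trans hV, hVW, hVl⟩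
    · intro j
      rcases hlam : lam P U with ⟨a, t⟩
      rw [hlam] at hne
      by_cases ha : j = a
      · subst ha
        cases t
        · left
          have : (j, true) ≠ (j, false) := by simp
          simpa [flipLabel, Pi.single_eq_of_ne this] using hne
        · right
          have : (j, false) ≠ (j, true) := by simp
          simpa [flipLabel, Pi.single_eq_of_ne this] using hne
      · have : ∀ t', (j, t') ≠ (a, t) := by
          intro t' h; exact ha (congrArg Prod.fst h)
        simpa [Pi.single_eq_of_ne (this _)] using h2 j

theorem flagSum_congr_sign {P Q : Finset ℕ} {f : (ℕ × Bool → ℕ) → ZMod 2}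
    (hPQ : ∀ U, U ⊆ W → lam P U = lam Q U) (k : ℕ) (U : Finset ℕ) (hU : U ⊆ W)
    (s : ℕ × Bool → ℕ) : flagSum lam f P k U s = flagSum lam f Q k U s := by
  induction k generalizing U s with
  | zero => rfl
  | succ k ih =>
    refine Finset.sum_congr rfl fun i hi => ?_
    rw [hPQ U hU]
    exact ih _ ((Finset.erase_subset i U).trans hU) _

theorem flagSum_flip {P Q : Finset ℕ} {f g : (ℕ × Bool → ℕ) → ZMod 2}
    (hfg : ∀ s, g (fun l => s (flipLabel l)) = f s)
    (hPQ : ∀ U, U ⊆ W → U.Nonempty → lam Q U = flipLabel (lam P U)) (k : ℕ) (U : Finset ℕ)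
    (hU : U ⊆ W) (s : ℕ × Bool → ℕ) :
    flagSum lam g Q k U (fun l => s (flipLabel l)) = flagSum lam f P k U s := by
  induction k generalizing U s with
  | zero => exact hfg s
  | succ k ih =>
    refine Finset.sum_congr rfl fun i hi => ?_
    rw [← ih _ ((Finset.erase_subset i U).trans hU) _, hPQ U hU ⟨i, hi⟩]
    congr 1
    ext l
    have : ∀ a b : ℕ × Bool, a = flipLabel b ↔ flipLabel a = b := by
      rintro ⟨a, t⟩ ⟨b, t'⟩
      simp only [flipLabel, Prod.mk.injEq]
      cases t <;> cases t' <;> simp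
    simp only [Pi.add_apply, Pi.single_apply, this]

theorem exists_of_flagSum_ne_zero (hm : ∀ P U, U ⊆ W → U.Nonempty → (lam P U).1 < m)
    {f : (ℕ × Bool → ℕ) → ZMod 2} {P : Finset ℕ} {k : ℕ} {U : Finset ℕ} (hU : U ⊆ W)
    {s : ℕ × Bool → ℕ} (h : flagSum lam f P k U s ≠ 0) :
    ∃ s', f s' ≠ 0 ∧ ∑ j ∈ Finset.range m, ∑ t : Bool, s' (j, t) =
      ∑ j ∈ Finset.range m, ∑ t : Bool, s (j, t) + k := by
  induction k generalizing U s with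
  | zero => exact ⟨s, h, by simp⟩
  | succ k ih =>
    obtain ⟨i, hi, hne⟩ := Finset.exists_ne_zero_of_sum_ne_zero h
    obtain ⟨s', h1, h2⟩ := ih ((Finset.erase_subset i U).trans hU) hne
    refine ⟨s', h1, ?_⟩
    have e : ∑ j ∈ Finset.range m, ∑ t : Bool, (Pi.single (lam P U) 1 : ℕ × Bool → ℕ) (j, t)
        = 1 := by
      rw [← Finset.sum_product' (Finset.range m) Finset.univ
        (fun j t => (Pi.single (lam P U) 1 : ℕ × Bool → ℕ) (j, t)),
        Finset.sum_eq_single (lam P U)]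
      · simp
      · intro b _ hb
        simp [Pi.single_eq_of_ne hb]
      · intro h
        have := hm P U hU ⟨i, hi⟩
        simp at h; omega
    rw [h2]
    simp only [Pi.add_apply, Finset.sum_add_distrib, e]
    ring

/-- **Ky Fan's parity theorem** for the barycentric subdivision of the cross-polytope. -/
theorem sum_flagSum_altSign {n : ℕ}
    (hm : ∀ P U, U ⊆ Finset.range n → U.Nonempty → (lam P U).1 < m)
    (hdep : ∀ P Q U, P ∩ U = Q ∩ U → lam P U = lam Q U)
    (hanti : ∀ P U, U.Nonempty → lam (U \ P) U = flipLabel (lam P U))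
    (hc : ∀ P U V, U.Nonempty → U ⊆ V → V ⊆ Finset.range n → lam P U ≠ flipLabel (lam P V))
    {k : ℕ} (hk : k ≤ n) :
    ∑ P ∈ (Finset.range k).powerset,
      flagSum lam (altSign m true) P k (Finset.range k) 0 = 1 := by
  induction k with
  | zero =>
    have : ∀ m b, altSign m b 0 = 1 := by
      intro m
      induction m with
      | zero => intro b; rfl
      | succ m ih => intro b; simp [altSign, ih]
    simp [flagSum, this]
  | succ k ih =>
    have hsub : Finset.range (k + 1) ⊆ Finset.range n := Finset.range_subset_range.2 hk
    set F := fun (P : Finset ℕ) => flagSum lam (altSign m true) P (k + 1) (Finset.range (k + 1)) 0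
    set G := fun (P : Finset ℕ) => flagSum lam (altSign m false) P (k + 1) (Finset.range (k + 1)) 0
    -- The door-counting step: modulo 2, the alternating flags of a facet, with either starting
    -- sign, are counted by those of its codimension-one faces.
    have h1 : ∀ P, F P + G P = ∑ i ∈ Finset.range (k + 1),
        flagSum lam (altSign m true) P k ((Finset.range (k + 1)).erase i) 0 := by
      intro P
      rw [← flagSum_face hm _ P k _ hsub (by simp)]
      have : ∀ (k : ℕ) (U : Finset ℕ) s, flagSum lam (altSign m true) P k U s +
          flagSum lam (altSign m false) P k U s =
          flagSum lam (fun s => altSign m true s + altSign m false s) P k U s := by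
        intro k
        induction k with
        | zero => intro U s; rfl
        | succ k ih =>
          intro U s
          simp only [flagSum]
          rw [← Finset.sum_add_distrib]
          exact Finset.sum_congr rfl fun i _ => ih _ _
      simp only [F, G]
      rw [this]
      refine flagSum_congr_left ?_ P (hc P) _ _ hsub _ ?_ ?_
      · intro s hs
        exact (labelCoboundary_altSign (fun j _ => hs j) true).symm
      · intro l hl; simp at hl
      · intro j; simp
    -- The antipodal map exchanges the hemispheres k ∈ P and k ∉ P and reverses all labels, so the
    -- sum of `F` over the sphere becomes a sum of `F + G` over one hemisphere.
    have h2 : ∀ P ∈ (Finset.range k).powerset, F (insert k P) = G (Finset.range k \ P) := by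
      intro P hP
      rw [Finset.mem_powerset] at hP
      refine (flagSum_flip (W := Finset.range (k + 1)) ?_ ?_ (k + 1) (Finset.range (k + 1)) subset_rfl
        (0 : ℕ × Bool → ℕ))
      · intro s; exact altSign_flip m false s
      · intro U hU hne
        rw [← hanti _ U hne]
        apply hdep
        ext x
        have hx : x ∈ U → x < k + 1 := fun h => Finset.mem_range.1 (hU h)
        have hxP : x ∈ P → x < k := fun h => Finset.mem_range.1 (hP h)
        simp only [Finset.mem_inter, Finset.mem_insert, Finset.mem_sdiff, Finset.mem_range]
        by_cases hxk : x = k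
        · simp [hxk]
        · constructor
          · rintro ⟨h | h, hU⟩
            · exact absurd h hxk
            · exact ⟨⟨hU, fun h' => h'.2 h⟩, hU⟩
          · rintro ⟨⟨h, h'⟩, _⟩
            have := hx h
            by_contra hcon
            exact h' ⟨by omega, fun hp => hcon ⟨Or.inr hp, h⟩⟩
    have h3 : ∑ P ∈ (Finset.range k).powerset, G (Finset.range k \ P)
        = ∑ P ∈ (Finset.range k).powerset, G P := by
      refine Finset.sum_nbij' (fun P => Finset.range k \ P) (fun P => Finset.range k \ P) ?_ ?_ ?_ ?_ ?_
      · intro P _; simp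
      · intro P _; simp
      · intro P hP; exact Finset.sdiff_sdiff_eq_self (Finset.mem_powerset.1 hP)
      · intro P hP; exact Finset.sdiff_sdiff_eq_self (Finset.mem_powerset.1 hP)
      · intro P _; rfl
    -- Faces interior to the hemisphere are shared by the facets `P` and `insert i P` and cancel;
    -- only the equator, where coordinate k is missing, survives and is handled by induction.
    have h4 : ∀ i ∈ Finset.range k, ∑ P ∈ (Finset.range k).powerset,
        flagSum lam (altSign m true) P k ((Finset.range (k + 1)).erase i) 0 = 0 := by
      intro i hi
      conv_lhs => rw [← Finset.insert_erase hi]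
      rw [Finset.sum_powerset_insert (Finset.notMem_erase i _), ← Finset.sum_add_distrib]
      refine Finset.sum_eq_zero fun P hP => ?_
      rw [flagSum_congr_sign (P := insert i P) (Q := P) (W := (Finset.range (k + 1)).erase i)
        _ _ _ subset_rfl]
      · exact CharTwo.add_self_eq_zero _
      · intro U hU
        apply hdep
        apply Finset.insert_inter_of_notMem
        intro h
        exact Finset.notMem_erase _ _ (hU h)
    calc ∑ P ∈ (Finset.range (k + 1)).powerset, F P
        = ∑ P ∈ (Finset.range k).powerset, F P +
            ∑ P ∈ (Finset.range k).powerset, F (insert k P) := by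
          rw [Finset.range_add_one, Finset.sum_powerset_insert Finset.notMem_range_self]
      _ = ∑ P ∈ (Finset.range k).powerset, (F P + G P) := by
          rw [Finset.sum_congr rfl h2, h3, Finset.sum_add_distrib]
      _ = ∑ i ∈ Finset.range (k + 1), ∑ P ∈ (Finset.range k).powerset,
            flagSum lam (altSign m true) P k ((Finset.range (k + 1)).erase i) 0 := by
          rw [Finset.sum_congr rfl fun P _ => h1 P, Finset.sum_comm]
      _ = 1 := by
          rw [Finset.sum_range_succ, Finset.sum_eq_zero h4, zero_add, ← ih (by omega)]
          refine Finset.sum_congr rfl fun P _ => ?_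
          rw [Finset.range_add_one, Finset.erase_insert Finset.notMem_range_self]

/-- **Tucker's lemma** in octahedral form. -/
theorem le_of_octahedral_labelling {n : ℕ}
    (hm : ∀ P U, U ⊆ Finset.range n → U.Nonempty → (lam P U).1 < m)
    (hdep : ∀ P Q U, P ∩ U = Q ∩ U → lam P U = lam Q U)
    (hanti : ∀ P U, U.Nonempty → lam (U \ P) U = flipLabel (lam P U))
    (hc : ∀ P U V, U.Nonempty → U ⊆ V → V ⊆ Finset.range n → lam P U ≠ flipLabel (lam P V)) :
    n ≤ m := by
  have h := sum_flagSum_altSign hm hdep hanti hc le_rfl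
  obtain ⟨P, -, hP⟩ := Finset.exists_ne_zero_of_sum_ne_zero (by rw [h]; exact one_ne_zero)
  obtain ⟨s, h1, h2⟩ := exists_of_flagSum_ne_zero hm subset_rfl hP
  have := altSign_sum_le h1
  simp only [Pi.zero_apply, Finset.sum_const_zero, zero_add] at h2
  omega

end Labelling

/-! ### The Lovász–Kneser theorem -/

/-- The least colour of a `k`-subset of `U` that lies in `Q` or in its complement. -/
noncomputable def leastColour (c : Finset ℕ → ℕ) (k : ℕ) (Q U : Finset ℕ) : ℕ :=
  sInf {x | ∃ v ∈ Finset.powersetCard k U, (v ⊆ Q ∨ Disjoint v Q) ∧ c v = x}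

open Classical in
/-- Matoušek's labelling of sign vectors (support `U`, positive part `Q`) attached to a colouring
of `k`-sets. -/
noncomputable def kneserLabel (c : Finset ℕ → ℕ) (k : ℕ) (Q U : Finset ℕ) : ℕ × Bool :=
  if U.card ≤ 2 * k - 2 then (U.card - 1, decide (∃ x ∈ U, x ∈ Q ∧ ∀ y ∈ U, x ≤ y))
  else (2 * k - 2 + leastColour c k Q U,
    decide (∃ v ∈ Finset.powersetCard k U, v ⊆ Q ∧ c v = leastColour c k Q U))

/-- By pigeonhole, `Q` or `U \ Q` has at least k elements once `U` has at least 2k - 1, so the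
infimum is not the default value of an empty set. -/
theorem exists_leastColour (c : Finset ℕ → ℕ) {k : ℕ} {Q U : Finset ℕ} (hQ : Q ⊆ U)
    (hU : 2 * k - 2 < U.card) :
    ∃ v ∈ Finset.powersetCard k U, (v ⊆ Q ∨ Disjoint v Q) ∧ c v = leastColour c k Q U := by
  refine Nat.sInf_mem (s := {x | ∃ v ∈ Finset.powersetCard k U, (v ⊆ Q ∨ Disjoint v Q) ∧ c v = x})
    ?_
  have h := Finset.card_sdiff_add_card_eq_card hQ
  rcases le_or_gt k Q.card with h1 | h1
  · obtain ⟨v, hv, hvk⟩ := Finset.exists_subset_card_eq h1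
    exact ⟨c v, v, Finset.mem_powersetCard.2 ⟨hv.trans hQ, hvk⟩, Or.inl hv, rfl⟩
  · obtain ⟨v, hv, hvk⟩ := Finset.exists_subset_card_eq (show k ≤ (U \ Q).card by omega)
    exact ⟨c v, v, Finset.mem_powersetCard.2 ⟨hv.trans Finset.sdiff_subset, hvk⟩,
      Or.inr (Finset.disjoint_of_subset_left hv Finset.sdiff_disjoint), rfl⟩

theorem leastColour_sdiff (c : Finset ℕ → ℕ) (k : ℕ) (Q U : Finset ℕ) :
    leastColour c k (U \ Q) U = leastColour c k Q U := by
  unfold leastColour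
  congr 1
  ext x
  refine exists_congr fun v => and_congr_right fun hv => and_congr_left fun _ => ?_
  have hvU := (Finset.mem_powersetCard.1 hv).1
  have h : Disjoint v (U \ Q) ↔ v ⊆ Q := by
    simp only [Finset.disjoint_left, Finset.mem_sdiff, not_and, not_not]
    exact ⟨fun h x hx => h hx (hvU hx), fun h x hx _ => h hx⟩
  rw [Finset.subset_sdiff, h, or_comm]
  simp [hvU]

/-- **The Lovász–Kneser theorem.** -/
theorem exists_disjoint_same_colour {n k r : ℕ} (hk : 1 ≤ k) (hn : 2 * k + r ≤ n + 1)
    (c : Finset ℕ → ℕ) (hc : ∀ v ∈ Finset.powersetCard k (Finset.range n), c v < r) :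
    ∃ v ∈ Finset.powersetCard k (Finset.range n), ∃ w ∈ Finset.powersetCard k (Finset.range n),
      Disjoint v w ∧ c v = c w := by
  by_contra! hcon
  have hmono : ∀ {U v}, U ⊆ Finset.range n → v ∈ Finset.powersetCard k U →
      v ∈ Finset.powersetCard k (Finset.range n) := fun hU hv =>
    Finset.powersetCard_mono hU hv
  -- outside the range the labels play no role
  set lam : Finset ℕ → Finset ℕ → ℕ × Bool := fun P U =>
    if U ⊆ Finset.range n then kneserLabel c k (P ∩ U) U
    else (0, decide (∃ x ∈ U, x ∈ P ∩ U ∧ ∀ y ∈ U, x ≤ y)) with hlam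
  have hmin : ∀ P U : Finset ℕ, U.Nonempty →
      ((∃ x ∈ U, x ∈ (U \ P) ∩ U ∧ ∀ y ∈ U, x ≤ y) ↔ ¬ ∃ x ∈ U, x ∈ P ∩ U ∧ ∀ y ∈ U, x ≤ y) := by
    intro P U hU
    constructor
    · rintro ⟨x, hx, hxP, hxm⟩ ⟨y, hy, hyP, hym⟩
      have : x = y := le_antisymm (hxm y hy) (hym x hx)
      subst this
      simp only [Finset.mem_inter, Finset.mem_sdiff] at hxP hyP
      exact hxP.1.2 hyP.1
    · intro h
      refine ⟨U.min' hU, U.min'_mem hU, ?_, fun y hy => U.min'_le y hy⟩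
      simp only [Finset.mem_inter, Finset.mem_sdiff, U.min'_mem hU, true_and, and_true]
      intro hP
      exact h ⟨_, U.min'_mem hU, Finset.mem_inter.2 ⟨hP, U.min'_mem hU⟩, fun y hy => U.min'_le y hy⟩
  have : n ≤ 2 * k - 2 + r := by
    refine le_of_octahedral_labelling (lam := lam) ?_ ?_ ?_ ?_
    · intro P U hU hne
      have := Finset.card_pos.2 hne
      simp only [hlam, if_pos hU, kneserLabel]
      split_ifs with h
      · simp only; omega
      · obtain ⟨v, hv, -, hcv⟩ := exists_leastColour c (k := k)
          (Finset.inter_subset_right (s₁ := P)) (not_le.1 h)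
        have := hc v (hmono hU hv)
        simp only; omega
    · intro P Q U h
      simp only [hlam, h]
    · intro P U hne
      simp only [hlam]
      split_ifs with hU
      · have e : (U \ P) ∩ U = U \ (P ∩ U) := by ext x; simp; tauto
        simp only [kneserLabel]
        split_ifs with h
        · simp only [flipLabel, Prod.mk.injEq, true_and, hmin P U hne]
          by_cases hh : ∃ x ∈ U, x ∈ P ∩ U ∧ ∀ y ∈ U, x ≤ y <;> simp only [hh] <;> simp
        · have hQ := Finset.inter_subset_right (s₁ := P) (s₂ := U)
          simp only [flipLabel, e, leastColour_sdiff c k, Prod.mk.injEq, true_and]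
          have : (∃ v ∈ Finset.powersetCard k U, v ⊆ U \ (P ∩ U) ∧
              c v = leastColour c k (P ∩ U) U) ↔ ¬ ∃ v ∈ Finset.powersetCard k U, v ⊆ P ∩ U ∧
              c v = leastColour c k (P ∩ U) U := by
            constructor
            · rintro ⟨v, hv, hvP, hcv⟩ ⟨w, hw, hwP, hcw⟩
              refine hcon v (hmono hU hv) w (hmono hU hw) ?_ (hcv.trans hcw.symm)
              exact Finset.disjoint_of_subset_left hvP
                (Finset.disjoint_of_subset_right hwP Finset.sdiff_disjoint)
            · intro hh
              obtain ⟨v, hv, hvP, hcv⟩ := exists_leastColour c (k := k) hQ (not_le.1 h)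
              refine ⟨v, hv, ?_, hcv⟩
              rcases hvP with hvP | hvP
              · exact absurd ⟨v, hv, hvP, hcv⟩ hh
              · exact Finset.subset_sdiff.2 ⟨(Finset.mem_powersetCard.1 hv).1, hvP⟩
          by_cases hh : ∃ v ∈ Finset.powersetCard k U, v ⊆ P ∩ U ∧
              c v = leastColour c k (P ∩ U) U <;> simp only [this, hh] <;> simp
      · simp only [flipLabel, Prod.mk.injEq, true_and, hmin P U hne]
        by_cases hh : ∃ x ∈ U, x ∈ P ∩ U ∧ ∀ y ∈ U, x ≤ y <;> simp only [hh] <;> simp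
    · intro P U V hne hUV hV heq
      have hU := hUV.trans hV
      have hUpos := Finset.card_pos.2 hne
      have hle := Finset.card_le_card hUV
      simp only [hlam, if_pos hU, if_pos hV, kneserLabel] at heq
      -- Small faces with equal absolute label have equal size, hence coincide and cannot have
      -- opposite signs. A small and a large face have labels in different ranges. For two large
      -- faces, opposite signs put two k-sets of the same colour on opposite sides, hence disjoint.
      split_ifs at heq with h1 h2 h2
      · have h := congrArg Prod.fst heq
        simp only [flipLabel] at h
        have : U = V := Finset.eq_of_subset_of_card_le hUV (by omega)
        subst this
        simp [flipLabel] at heq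
      · have h := congrArg Prod.fst heq
        simp only [flipLabel] at h
        omega
      · omega
      · have h := congrArg Prod.fst heq
        have h' := congrArg Prod.snd heq
        simp only [flipLabel] at h h'
        have hj : leastColour c k (P ∩ U) U = leastColour c k (P ∩ V) V := by omega
        obtain ⟨v, hv, hvP, hcv⟩ := exists_leastColour c (k := k)
          (Finset.inter_subset_right (s₁ := P) (s₂ := U)) (not_le.1 h1)
        obtain ⟨w, hw, hwP, hcw⟩ := exists_leastColour c (k := k)
          (Finset.inter_subset_right (s₁ := P) (s₂ := V)) (not_le.1 h2)
        have hvU := (Finset.mem_powersetCard.1 hv).1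
        by_cases hh : ∃ v ∈ Finset.powersetCard k U, v ⊆ P ∩ U ∧ c v = leastColour c k (P ∩ U) U
        · have hn : ¬ ∃ v ∈ Finset.powersetCard k V, v ⊆ P ∩ V ∧
              c v = leastColour c k (P ∩ V) V := by
            intro hn; simp only [hh, hn] at h'; simp at h'
          obtain ⟨v', hv', hvP', hcv'⟩ := hh
          have hw' : Disjoint w (P ∩ V) := hwP.resolve_left fun h => hn ⟨w, hw, h, hcw⟩
          refine hcon v' (hmono hU hv') w (hmono hV hw) ?_ (by omega)
          exact Finset.disjoint_of_subset_left
            (hvP'.trans (Finset.inter_subset_inter_left hUV)) hw'.symm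
        · have hn : ∃ v ∈ Finset.powersetCard k V, v ⊆ P ∩ V ∧
              c v = leastColour c k (P ∩ V) V := by
            by_contra hn; simp only [hh, hn] at h'; simp at h'
          obtain ⟨w', hw', hwP', hcw'⟩ := hn
          have hv' : Disjoint v (P ∩ U) := hvP.resolve_left fun h => hh ⟨v, hv, h, hcv⟩
          refine hcon v (hmono hU hv) w' (hmono hV hw') ?_ (by omega)
          rw [Finset.disjoint_left] at hv' ⊢
          intro x hx hxw
          exact hv' hx (Finset.mem_inter.2 ⟨(Finset.mem_inter.1 (hwP' hxw)).1, hvU hx⟩)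
  omega

/-! ### Simultaneous approximation along an infinite set -/

theorem Set.Infinite.exists_lt_abs {E : Set ℤ} (hE : E.Infinite) (K : ℝ) :
    ∃ x ∈ E, K < |(x : ℝ)| := by
  by_contra! h
  refine hE ((Set.finite_Icc (-⌈K⌉) ⌈K⌉).subset fun x hx => ?_)
  have h1 := (h x hx).trans (Int.le_ceil K)
  rw [← Int.cast_abs, Int.cast_le] at h1
  exact abs_le.1 h1

/-- From an infinite set of integers one can choose finitely many whose multiples of a suitable
small real number approximate arbitrary prescribed values modulo `1`. -/
theorem exists_simultaneous_approx {E : Set ℤ} (hE : E.Infinite) {ι : Type*} [DecidableEq ι]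
    (I : Finset ι) {ε : ℝ} (hε : 0 < ε) :
    ∃ e : ι → ℤ, (∀ i, e i ∈ E) ∧ ∀ t : ι → ℝ, ∃ α : ℝ, |α| ≤ ε ∧
      ∀ i ∈ I, ∃ z : ℤ, |e i * α - t i - z| ≤ ε := by
  induction I using Finset.induction generalizing ε with
  | empty =>
    obtain ⟨x, hx⟩ := hE.nonempty
    exact ⟨fun _ => x, fun _ => hx, fun t => ⟨0, by simpa using hε.le, by simp⟩⟩
  | insert j I hj ih =>
    obtain ⟨e, he, h⟩ := ih (half_pos hε)
    have hsum : 0 ≤ ∑ i ∈ I, |(e i : ℝ)| := Finset.sum_nonneg fun _ _ => abs_nonneg _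
    -- The new element is so large that a correction of α of size 1/|x|, enough to put its multiple
    -- exactly on target, disturbs the earlier multiples by at most ε/2. Its choice does not depend
    -- on the targets.
    obtain ⟨x, hx, hxK⟩ := hE.exists_lt_abs ((1 + ∑ i ∈ I, |(e i : ℝ)|) * (2 / ε))
    have hx0 : 0 < |(x : ℝ)| := lt_trans (by positivity) hxK
    have hxne : (x : ℝ) ≠ 0 := abs_pos.1 hx0
    have hinv : (1 + ∑ i ∈ I, |(e i : ℝ)|) * (1 / |(x : ℝ)|) ≤ ε / 2 := by
      rw [mul_one_div, div_le_iff₀ hx0]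
      have := mul_le_mul_of_nonneg_left hxK.le (half_pos hε).le
      calc _ = ε / 2 * ((1 + ∑ i ∈ I, |(e i : ℝ)|) * (2 / ε)) := by field_simp
        _ ≤ _ := this
    have hinv0 : 0 ≤ 1 / |(x : ℝ)| := by positivity
    refine ⟨Function.update e j x, fun i => ?_, fun t => ?_⟩
    · by_cases hi : i = j
      · subst hi; simpa using hx
      · simpa [hi] using he i
    · obtain ⟨α, hα, hz⟩ := h t
      set z := round (x * α - t j)
      set β := (t j + z - x * α) / x with hβ
      have hβ1 : |β| ≤ 1 / |(x : ℝ)| := by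
        rw [hβ, abs_div]
        gcongr
        have := abs_sub_round (x * α - t j)
        rw [abs_sub_comm] at this
        calc |t j + z - x * α| = |z - (x * α - t j)| := by congr 1; ring
          _ ≤ 1 / 2 := this
          _ ≤ 1 := by norm_num
      refine ⟨α + β, ?_, fun i hi => ?_⟩
      · have := abs_add_le α β
        nlinarith
      · rcases Finset.mem_insert.1 hi with rfl | hi
        · refine ⟨z, ?_⟩
          rw [Function.update_self, mul_add, hβ, mul_div_cancel₀ _ hxne]
          have : x * α + (t i + z - x * α) - t i - z = 0 := by ring
          rw [this, abs_zero]; exact hε.le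
        · obtain ⟨y, hy⟩ := hz i hi
          refine ⟨y, ?_⟩
          have hij : i ≠ j := fun h => hj (h ▸ hi)
          rw [Function.update_of_ne hij]
          have h1 : |(e i : ℝ) * β| ≤ ε / 2 := by
            rw [abs_mul]
            refine le_trans ?_ hinv
            have h2 : |(e i : ℝ)| ≤ ∑ i ∈ I, |(e i : ℝ)| :=
              Finset.single_le_sum (f := fun i => |(e i : ℝ)|) (fun _ _ => abs_nonneg _) hi
            gcongr
            linarith
          calc |e i * (α + β) - t i - y| = |(e i * α - t i - y) + e i * β| := by congr 1; ring
            _ ≤ |e i * α - t i - y| + |e i * β| := abs_add_le _ _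
            _ ≤ ε := by linarith

/-! ### The middle layers of the cube are thin -/

/-- The factor 2k + 1 makes the induction close, through (2k + 1)(2k + 3) ≤ (2k + 2)². -/
theorem centralBinom_sq_le (k : ℕ) : k.centralBinom ^ 2 * (2 * k + 1) ≤ 16 ^ k := by
  induction k with
  | zero => simp
  | succ k ih =>
    have h := Nat.succ_mul_centralBinom_succ k
    refine Nat.le_of_mul_le_mul_left ?_ (show 0 < (k + 1) ^ 2 by positivity)
    calc (k + 1) ^ 2 * ((k + 1).centralBinom ^ 2 * (2 * (k + 1) + 1))
        = ((k + 1) * (k + 1).centralBinom) ^ 2 * (2 * k + 3) := by ring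
      _ = (k.centralBinom ^ 2 * (2 * k + 1)) * (4 * (2 * k + 1) * (2 * k + 3)) := by rw [h]; ring
      _ ≤ 16 ^ k * (4 * (2 * k + 1) * (2 * k + 3)) := Nat.mul_le_mul_right _ ih
      _ ≤ 16 ^ k * (16 * (k + 1) ^ 2) := Nat.mul_le_mul_left _ (by nlinarith)
      _ = (k + 1) ^ 2 * 16 ^ (k + 1) := by ring

theorem choose_le_two_pow_mul_centralBinom (k r j : ℕ) :
    (2 * k + r).choose j ≤ 2 ^ r * k.centralBinom := by
  induction r generalizing j with
  | zero => simpa using Nat.choose_le_centralBinom j k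
  | succ r ih =>
    rcases j with _ | j
    · have := ih 0
      simp only [Nat.choose_zero_right] at this ⊢
      rw [pow_succ]; linarith
    · rw [← add_assoc, Nat.choose_succ_succ, pow_succ]
      have := ih j
      have := ih (j + 1)
      linarith

open Filter Topology in
theorem tendsto_centralBinom_div :
    Tendsto (fun k : ℕ => (k.centralBinom : ℝ) / 4 ^ k) atTop (𝓝 0) := by
  have h : Tendsto (fun k : ℕ => Real.sqrt (1 / ((k : ℝ) + 1))) atTop (𝓝 0) := by
    have := (Real.continuous_sqrt.tendsto 0).comp tendsto_one_div_add_atTop_nhds_zero_nat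
    rwa [Real.sqrt_zero] at this
  refine squeeze_zero (fun k => by positivity) (fun k => ?_) h
  apply Real.le_sqrt_of_sq_le
  rw [div_pow, ← pow_mul, mul_comm k 2, pow_mul, div_le_div_iff₀ (by positivity) (by positivity)]
  have h := centralBinom_sq_le k
  have h' : (k.centralBinom : ℝ) ^ 2 * (2 * k + 1) ≤ 16 ^ k := by exact_mod_cast h
  have : (0 : ℝ) ≤ (k.centralBinom : ℝ) ^ 2 * k := by positivity
  norm_num
  linarith

/-- Most subsets of a set with `2k + r` elements, `k` large, do not have nearly half of the
elements. -/
theorem exists_few_balanced (r : ℕ) {η : ℝ} (hη : 0 < η) : ∃ k : ℕ, 1 ≤ k ∧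
    ((Finset.univ.filter fun P : Finset (Fin (2 * k + r)) =>
      P.card ∈ Finset.Icc k (k + r)).card : ℝ) ≤ η * 2 ^ (2 * k + r) := by
  have h := (tendsto_centralBinom_div.const_mul ((r : ℝ) + 1)).eventually_lt_const
    (u := η) (by simpa using hη)
  obtain ⟨k, hk, hk1⟩ := (h.and (Filter.eventually_ge_atTop 1)).exists
  refine ⟨k, hk1, ?_⟩
  have hcard : (Finset.univ.filter fun P : Finset (Fin (2 * k + r)) =>
      P.card ∈ Finset.Icc k (k + r)).card ≤ (r + 1) * (2 ^ r * k.centralBinom) := by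
    have hsub : (Finset.univ.filter fun P : Finset (Fin (2 * k + r)) =>
        P.card ∈ Finset.Icc k (k + r)) ⊆ (Finset.Icc k (k + r)).biUnion
          fun j => Finset.powersetCard j Finset.univ := by
      intro P hP
      simp only [Finset.mem_filter, Finset.mem_univ, true_and] at hP
      simp only [Finset.mem_biUnion, Finset.mem_powersetCard, Finset.subset_univ, true_and]
      exact ⟨_, hP, rfl⟩
    refine (Finset.card_le_card hsub).trans (Finset.card_biUnion_le.trans ?_)
    have : (Finset.Icc k (k + r)).card = r + 1 := by simp; omega
    rw [← this, ← smul_eq_mul]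
    refine Finset.sum_le_card_nsmul _ _ _ fun j _ => ?_
    rw [Finset.card_powersetCard, Finset.card_univ, Fintype.card_fin]
    exact choose_le_two_pow_mul_centralBinom k r j
  calc ((Finset.univ.filter fun P : Finset (Fin (2 * k + r)) =>
      P.card ∈ Finset.Icc k (k + r)).card : ℝ) ≤ ((r + 1) * (2 ^ r * k.centralBinom) : ℕ) := by
        exact_mod_cast hcard
    _ = ((r : ℝ) + 1) * (k.centralBinom / 4 ^ k) * 2 ^ (2 * k + r) := by
        rw [pow_add, pow_mul]; push_cast; norm_num; field_simp
    _ ≤ η * 2 ^ (2 * k + r) := by gcongr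

/-! ### Majority signs on a discrete torus -/

/-- The arc of residues modulo `2h` represented in `[m, h - m)`. -/
def plusArc (m h : ℕ) : Set (ZMod (2 * h)) :=
  {y | ∃ z : ℤ, (m : ℤ) ≤ z ∧ z < h - m ∧ (z : ZMod (2 * h)) = y}

/-- The arc of residues modulo `2h` represented in `[h + m, 2h - m)`. -/
def minusArc (m h : ℕ) : Set (ZMod (2 * h)) :=
  {y | ∃ z : ℤ, (h : ℤ) + m ≤ z ∧ z < 2 * h - m ∧ (z : ZMod (2 * h)) = y}

theorem exists_eq_add_mul_of_cast_eq {h : ℕ} {a b : ℤ} (H : (a : ZMod (2 * h)) = b) :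
    ∃ c : ℤ, b = a + 2 * h * c := by
  rw [ZMod.intCast_eq_intCast_iff_dvd_sub] at H
  obtain ⟨c, hc⟩ := H
  exact ⟨c, by push_cast at hc; linarith⟩

theorem false_of_lt_mul {h : ℕ} {c x : ℤ} (hx : x = 2 * h * c) (h1 : -(2 * h : ℤ) < x)
    (h2 : x < 2 * h) (h0 : x ≠ 0) : False := by
  rcases lt_trichotomy c 0 with hc | hc | hc
  · nlinarith
  · subst hc; simp at hx; exact h0 hx
  · nlinarith

/-- Such a shift carries [m, h - m) into [h, 2h): the gaps of length m absorb the deviation from an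
exact half turn. -/
theorem notMem_plusArc_add {m h : ℕ} {u : ℤ} (hu : |u - h| ≤ m) {y : ZMod (2 * h)}
    (hy : y ∈ plusArc m h) : y + u ∉ plusArc m h := by
  rintro ⟨z', h1, h2, h3⟩
  obtain ⟨z, h4, h5, rfl⟩ := hy
  rw [← Int.cast_add] at h3
  obtain ⟨c, hc⟩ := exists_eq_add_mul_of_cast_eq h3.symm
  rw [abs_le] at hu
  exact false_of_lt_mul (show z' - (z + u) = 2 * h * c by linarith) (by omega) (by omega) (by omega)

theorem notMem_minusArc_add {m h : ℕ} {u : ℤ} (hu : |u - h| ≤ m) {y : ZMod (2 * h)}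
    (hy : y ∈ minusArc m h) : y + u ∉ minusArc m h := by
  rintro ⟨z', h1, h2, h3⟩
  obtain ⟨z, h4, h5, rfl⟩ := hy
  rw [← Int.cast_add] at h3
  obtain ⟨c, hc⟩ := exists_eq_add_mul_of_cast_eq h3.symm
  rw [abs_le] at hu
  exact false_of_lt_mul (show z' - (z + u) = 2 * h * c by linarith) (by omega) (by omega) (by omega)

theorem notMem_minusArc_of_plusArc {m h : ℕ} {u : ℤ} (hu : |u| ≤ m) {y : ZMod (2 * h)}
    (hy : y ∈ plusArc m h) : y + u ∉ minusArc m h := by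
  rintro ⟨z', h1, h2, h3⟩
  obtain ⟨z, h4, h5, rfl⟩ := hy
  rw [← Int.cast_add] at h3
  obtain ⟨c, hc⟩ := exists_eq_add_mul_of_cast_eq h3.symm
  rw [abs_le] at hu
  exact false_of_lt_mul (show z' - (z + u) = 2 * h * c by linarith) (by omega) (by omega) (by omega)

theorem notMem_plusArc_of_minusArc {m h : ℕ} {u : ℤ} (hu : |u| ≤ m) {y : ZMod (2 * h)}
    (hy : y ∈ minusArc m h) : y + u ∉ plusArc m h := by
  intro hy'
  apply notMem_minusArc_of_plusArc (u := -u) (by rwa [abs_neg]) hy'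
  simpa using hy

open Classical in
/-- The sign of a point of `(ℤ / 2h)ⁿ` that has more than `(n + r) / 2` coordinates in one of the
two arcs. -/
noncomputable def majoritySign (m h n r : ℕ) (x : Fin n → ZMod (2 * h)) : SignType :=
  if n + r < 2 * (Finset.univ.filter fun i => x i ∈ plusArc m h).card then 1
  else if n + r < 2 * (Finset.univ.filter fun i => x i ∈ minusArc m h).card then -1
  else 0

/-- This explains the threshold (n + r)/2: two sets of coordinates overlapping in at most r places
cannot both exceed it. -/
theorem card_add_card_le {n r : ℕ} {A B C : Finset (Fin n)} (h : A ∩ B ⊆ C) (hC : C.card ≤ r) :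
    A.card + B.card ≤ n + r := by
  rw [← Finset.card_union_add_card_inter]
  have h1 := Finset.card_le_univ (A ∪ B)
  rw [Fintype.card_fin] at h1
  have h2 := Finset.card_le_card h
  omega

theorem majoritySign_mul_ne_one {m h n r : ℕ} {x y : Fin n → ZMod (2 * h)} {C : Finset (Fin n)}
    (hC : C.card ≤ r) (hxy : ∀ i ∉ C, ∃ u : ℤ, |u - h| ≤ m ∧ y i = x i + u) :
    majoritySign m h n r x * majoritySign m h n r y ≠ 1 := by
  classical
  have hp := card_add_card_le (n := n) (A := Finset.univ.filter fun i => x i ∈ plusArc m h)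
    (B := Finset.univ.filter fun i => y i ∈ plusArc m h) (C := C) (by
      intro i hi
      simp only [Finset.mem_inter, Finset.mem_filter, Finset.mem_univ, true_and] at hi
      by_contra hiC
      obtain ⟨u, hu, hy⟩ := hxy i hiC
      exact notMem_plusArc_add hu hi.1 (hy ▸ hi.2)) hC
  have hm := card_add_card_le (n := n) (A := Finset.univ.filter fun i => x i ∈ minusArc m h)
    (B := Finset.univ.filter fun i => y i ∈ minusArc m h) (C := C) (by
      intro i hi
      simp only [Finset.mem_inter, Finset.mem_filter, Finset.mem_univ, true_and] at hi
      by_contra hiC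
      obtain ⟨u, hu, hy⟩ := hxy i hiC
      exact notMem_minusArc_add hu hi.1 (hy ▸ hi.2)) hC
  unfold majoritySign
  split_ifs
  all_goals first | decide | (exfalso; omega)

theorem majoritySign_mul_ne_neg_one {m h n r : ℕ} {x y : Fin n → ZMod (2 * h)}
    (hxy : ∀ i, ∃ u : ℤ, |u| ≤ m ∧ y i = x i + u) :
    majoritySign m h n r x * majoritySign m h n r y ≠ -1 := by
  classical
  have hp := card_add_card_le (n := n) (A := Finset.univ.filter fun i => x i ∈ plusArc m h)
    (B := Finset.univ.filter fun i => y i ∈ minusArc m h) (C := ∅) (r := r) (by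
      intro i hi
      simp only [Finset.mem_inter, Finset.mem_filter, Finset.mem_univ, true_and] at hi
      obtain ⟨u, hu, hy⟩ := hxy i
      exact absurd (hy ▸ hi.2) (notMem_minusArc_of_plusArc hu hi.1)) (by simp)
  have hm := card_add_card_le (n := n) (A := Finset.univ.filter fun i => x i ∈ minusArc m h)
    (B := Finset.univ.filter fun i => y i ∈ plusArc m h) (C := ∅) (r := r) (by
      intro i hi
      simp only [Finset.mem_inter, Finset.mem_filter, Finset.mem_univ, true_and] at hi
      obtain ⟨u, hu, hy⟩ := hxy i
      exact absurd (hy ▸ hi.2) (notMem_plusArc_of_minusArc hu hi.1)) (by simp)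
  unfold majoritySign
  split_ifs
  all_goals first | decide | (exfalso; omega)

/-- Choose the set `P` of coordinates in the plus arc and a position among q places in each arc. If
|P| is outside [k, k + r], then `P` or its complement has at least k + r + 1 elements, just above (n
+ r)/2 = k + r. -/
theorem le_card_majoritySign_ne_zero {m h k r q : ℕ} [NeZero (2 * h)] (hq : q + 2 * m ≤ h) :
    (2 ^ (2 * k + r) - (Finset.univ.filter fun P : Finset (Fin (2 * k + r)) =>
      P.card ∈ Finset.Icc k (k + r)).card) * q ^ (2 * k + r) ≤
    (Finset.univ.filter fun x : Fin (2 * k + r) → ZMod (2 * h) =>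
      majoritySign m h (2 * k + r) r x ≠ 0).card := by
  set n := 2 * k + r with hn
  set good := Finset.univ.filter fun P : Finset (Fin n) => ¬ P.card ∈ Finset.Icc k (k + r)
  have hgood : 2 ^ n - (Finset.univ.filter fun P : Finset (Fin n) =>
      P.card ∈ Finset.Icc k (k + r)).card = good.card := by
    have := Finset.card_filter_add_card_filter_not (s := (Finset.univ : Finset (Finset (Fin n))))
      (fun P => P.card ∈ Finset.Icc k (k + r))
    rw [Finset.card_univ, Fintype.card_finset, Fintype.card_fin] at this
    rw [← this, Nat.add_sub_cancel_left]
  classical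
  have hfun : q ^ n = (Finset.univ : Finset (Fin n → Fin q)).card := by simp
  rw [hgood, hfun, ← Finset.card_product]
  set N : Finset (Fin n) → (Fin n → Fin q) → Fin n → ℕ :=
    fun P y i => m + y i + if i ∈ P then 0 else h with hN
  have hNlt : ∀ P y i, N P y i < 2 * h := by
    intro P y i
    have := (y i).2
    simp only [hN]; split_ifs <;> omega
  refine Finset.card_le_card_of_injOn (fun p i => (N p.1 p.2 i : ZMod (2 * h))) ?_ ?_
  · rintro ⟨P, y⟩ hP
    simp only [good, Finset.coe_product, Finset.coe_filter, Finset.coe_univ, Finset.mem_univ,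
      true_and, Set.mem_prod, Set.mem_ofPred_eq, Set.mem_univ, and_true, Finset.mem_Icc] at hP
    simp only [Finset.coe_filter, Finset.mem_univ, true_and, Set.mem_ofPred_eq]
    have h1 : P ⊆ Finset.univ.filter fun i => (N P y i : ZMod (2 * h)) ∈ plusArc m h := by
      intro i hi
      have := (y i).2
      refine Finset.mem_filter.2 ⟨Finset.mem_univ _, N P y i, ?_, ?_, by simp⟩ <;>
        simp only [hN, if_pos hi] <;> push_cast <;> omega
    have h2 : Pᶜ ⊆ Finset.univ.filter fun i => (N P y i : ZMod (2 * h)) ∈ minusArc m h := by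
      intro i hi
      rw [Finset.mem_compl] at hi
      have := (y i).2
      refine Finset.mem_filter.2 ⟨Finset.mem_univ _, N P y i, ?_, ?_, by simp⟩ <;>
        simp only [hN, if_neg hi] <;> push_cast <;> omega
    have h3 := Finset.card_le_card h1
    have h4 := Finset.card_le_card h2
    rw [Finset.card_compl, Fintype.card_fin] at h4
    unfold majoritySign
    dsimp only
    split_ifs with h5 h6
    · decide
    · decide
    · exfalso; omega
  · rintro ⟨P, y⟩ - ⟨P', y'⟩ - heq
    have hNeq : ∀ i, N P y i = N P' y' i := by
      intro i
      have := congrFun heq i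
      simp only at this
      rwa [ZMod.natCast_eq_natCast_iff', Nat.mod_eq_of_lt (hNlt _ _ _),
        Nat.mod_eq_of_lt (hNlt _ _ _)] at this
    have hPP : ∀ i, (i ∈ P ↔ i ∈ P') ∧ y i = y' i := by
      intro i
      have h1 := hNeq i
      have := (y i).2
      have := (y' i).2
      simp only [hN] at h1
      by_cases hi : i ∈ P <;> by_cases hi' : i ∈ P' <;> simp only [hi, hi', if_true, if_false] at h1
      · exact ⟨by simp [hi, hi'], by ext; omega⟩
      · omega
      · omega
      · exact ⟨by simp [hi, hi'], by ext; omega⟩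
    rw [Prod.mk.injEq]
    exact ⟨Finset.ext fun i => (hPP i).1, funext fun i => (hPP i).2⟩

/-! ### Kneser differences as rotations -/

/-- Every `r`-colouring of `ℤ` has two points of the same colour whose difference is in `S`. -/
def IsColourRecurrent (r : ℕ) (S : Set ℤ) : Prop :=
  ∀ c : ℤ → Fin r, ∃ a b, c a = c b ∧ a - b ∈ S

theorem zpow_addRight_apply {G : Type*} [AddCommGroup G] (a x : G) (n : ℤ) :
    (Equiv.addRight a ^ n : Equiv.Perm G) x = x + n • a := by
  induction n generalizing x with
  | zero => simp
  | succ n ih =>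
    rw [zpow_add_one, Equiv.Perm.mul_apply, ih, Equiv.coe_addRight, add_zsmul, one_zsmul, add_assoc,
      add_comm a]
  | pred n ih =>
    rw [zpow_sub_one, Equiv.Perm.mul_apply, ih, sub_zsmul, one_zsmul]
    have : (Equiv.addRight a)⁻¹ x = x - a := by
      rw [Equiv.Perm.inv_def, Equiv.addRight_symm, Equiv.coe_addRight, sub_eq_add_neg]
    rw [this]
    abel

theorem round_near {e a α t M m : ℝ} {z : ℤ} (ha : |a - α * M| ≤ 1 / 2) (he : |e| ≤ m / 4)
    (hM : 0 ≤ M) (hz : |e * α - t - z| * M ≤ m / 4) : |e * a - t * M - z * M| ≤ m / 2 := by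
  have h1 : e * a - t * M - z * M = e * (a - α * M) + (e * α - t - z) * M := by ring
  have h2 : |e * (a - α * M)| ≤ m / 4 := by
    rw [abs_mul]
    have := mul_le_mul he ha (abs_nonneg _) (le_trans (abs_nonneg _) he)
    have := (abs_nonneg e).trans he
    linarith
  rw [h1]
  refine (abs_add_le _ _).trans ?_
  rw [abs_mul (e * α - t - z), abs_of_nonneg hM]
  linarith

theorem card_filter_notMem_union {n k r : ℕ} (hn : n = 2 * k + r) {v w : Finset ℕ}
    (hv : v ∈ Finset.powersetCard k (Finset.range n))
    (hw : w ∈ Finset.powersetCard k (Finset.range n)) (hd : Disjoint v w) :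
    (Finset.univ.filter fun i : Fin n => (i : ℕ) ∉ v ∪ w).card ≤ r := by
  rw [Finset.mem_powersetCard] at hv hw
  have h1 := Finset.card_filter_add_card_filter_not (s := (Finset.univ : Finset (Fin n)))
    (fun i => (i : ℕ) ∈ v ∪ w)
  have h2 : (v ∪ w).card ≤ (Finset.univ.filter fun i : Fin n => (i : ℕ) ∈ v ∪ w).card := by
    rw [← Finset.card_image_of_injective (Finset.univ.filter fun i : Fin n => (i : ℕ) ∈ v ∪ w)
      Fin.val_injective]
    refine Finset.card_le_card fun x hx => ?_
    have hxn : x < n := by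
      rcases Finset.mem_union.1 hx with h | h
      · exact Finset.mem_range.1 (hv.1 h)
      · exact Finset.mem_range.1 (hw.1 h)
    exact Finset.mem_image.2 ⟨⟨x, hxn⟩, Finset.mem_filter.2 ⟨Finset.mem_univ _, hx⟩, rfl⟩
  rw [Finset.card_union_of_disjoint hd, hv.2, hw.2] at h2
  rw [Finset.card_univ, Fintype.card_fin] at h1
  omega

/-- The arcs cover a proportion 1 - 2/R of each circle. Bernoulli's inequality bounds the loss over
n coordinates by 2n/R ≤ η/2, and balanced sets cost another η/2. -/
theorem density_estimate {n m R bad : ℕ} {η : ℝ} (hη : η ≤ 1) (hR : 2 ≤ R)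
    (hRn : 4 * (n : ℝ) ≤ η * R) (hη0 : 0 ≤ η) (hbad : (bad : ℝ) ≤ η / 2 * 2 ^ n) :
    (1 - η) * ((2 * (m * R) : ℕ) : ℝ) ^ n ≤ (((2 ^ n - bad) * (m * (R - 2)) ^ n : ℕ) : ℝ) := by
  have hR0 : (0 : ℝ) < R := by exact_mod_cast (by omega : 0 < R)
  have h1 : (1 - η / 2) * 2 ^ n ≤ ((2 ^ n - bad : ℕ) : ℝ) := by
    have : 2 ^ n ≤ (2 ^ n - bad) + bad := by omega
    have : (2 : ℝ) ^ n ≤ ((2 ^ n - bad : ℕ) : ℝ) + bad := by exact_mod_cast this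
    linarith
  have h2 : 1 - η / 2 ≤ (1 + -(2 / (R : ℝ))) ^ n := by
    refine le_trans ?_ (one_add_mul_le_pow ?_ n)
    · have : (n : ℝ) * (2 / R) ≤ η / 2 := by
        rw [mul_div_assoc', div_le_iff₀ hR0]; linarith
      linarith
    · have : (2 : ℝ) / R ≤ 1 := by
        rw [div_le_one hR0]; exact_mod_cast hR
      linarith
  have h3 : ((m * (R - 2) : ℕ) : ℝ) = m * R * (1 + -(2 / (R : ℝ))) := by
    rw [Nat.cast_mul, Nat.cast_sub hR]
    field_simp
    push_cast
    ring
  rw [Nat.cast_mul (2 ^ n - bad), Nat.cast_pow (m * (R - 2)), h3]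
  rw [Nat.cast_mul, Nat.cast_mul]
  rw [Nat.cast_ofNat]
  rw [mul_pow 2 ((m : ℝ) * R), mul_pow _ (1 + -(2 / (R : ℝ)))]
  have hX : (0 : ℝ) ≤ ((m : ℝ) * R) ^ n := by positivity
  calc (1 - η) * (2 ^ n * ((m : ℝ) * R) ^ n)
      ≤ ((1 - η / 2) * (1 - η / 2)) * (2 ^ n * ((m : ℝ) * R) ^ n) := by
        gcongr; nlinarith
    _ = ((1 - η / 2) * 2 ^ n) * (((m : ℝ) * R) ^ n * (1 - η / 2)) := by ring
    _ ≤ ((2 ^ n - bad : ℕ) : ℝ) * (((m : ℝ) * R) ^ n * (1 + -(2 / (R : ℝ))) ^ n) := by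
        have : 0 ≤ 1 - η / 2 := by linarith
        gcongr

/-- Kneser graphs inside `E - E`: a finite set of differences which is recurrent for
`r`-colourings, together with a rotation of a finite group and a sign function, defined on most of
the group, which changes sign along these differences and is stable along short differences. -/
theorem exists_kneser_rotation {E : Set ℤ} (hE : E.Infinite) (r L : ℕ) {η : ℝ} (hη0 : 0 < η)
    (hη : η ≤ 1) :
    ∃ S : Finset ℤ, (S : Set ℤ) ⊆ E - E ∧ IsColourRecurrent r S ∧
      ∃ (Ω : Type) (_ : Fintype Ω) (_ : Nonempty Ω) (T : Equiv.Perm Ω) (f : Ω → SignType),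
        (∀ s ∈ S, ∀ x, f x * f ((T ^ s) x) ≠ 1) ∧
        (∀ s : ℤ, |s| ≤ L → ∀ x, f x * f ((T ^ s) x) ≠ -1) ∧
        (1 - η) * Fintype.card Ω ≤ (Finset.univ.filter fun x => f x ≠ 0).card := by
  obtain ⟨k, hk, hbad⟩ := exists_few_balanced r (half_pos hη0)
  obtain ⟨n, hn⟩ : ∃ n, n = 2 * k + r := ⟨_, rfl⟩
  obtain ⟨R₀, hR₀⟩ := exists_nat_ge (4 * (n : ℝ) / η)
  obtain ⟨R, hR⟩ : ∃ R, R = R₀ + 2 := ⟨_, rfl⟩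
  have hRn : 4 * (n : ℝ) ≤ η * R := by
    rw [div_le_iff₀ hη0] at hR₀
    rw [hR]; push_cast; nlinarith
  have hRpos : (0 : ℝ) < R := by rw [hR]; positivity
  set I := Finset.powersetCard k (Finset.range n) with hI
  -- On a circle of length 2h = 2mR an error ε becomes m/(4(L + 1)), which stays within m/4 even
  -- after L steps.
  set ε : ℝ := 1 / (8 * R * (L + 1)) with hε
  obtain ⟨e, heE, happ⟩ := exists_simultaneous_approx hE I (show 0 < ε by positivity)
  choose α hα hz using fun i : Fin n =>
    happ (fun v => if (i : ℕ) ∈ v then 1 / 2 else 0)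
  -- The gap m must dominate the errors from rounding 2hα_i to an integer: multiplied by e(v),
  -- controlled by the sum, or by a time of size at most L, controlled by 2L.
  obtain ⟨m, hm⟩ : ∃ m : ℕ, m = 4 * ∑ v ∈ I, (e v).natAbs + 2 * L + 1 := ⟨_, rfl⟩
  obtain ⟨h, hh⟩ : ∃ h, h = m * R := ⟨_, rfl⟩
  have hmpos : (0 : ℝ) < m := by rw [hm]; positivity
  have hMR : ((2 * h : ℕ) : ℝ) = 2 * (m * R) := by rw [hh]; push_cast; ring
  have hMpos : (0 : ℝ) < ((2 * h : ℕ) : ℝ) := by rw [hMR]; positivity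
  have : NeZero (2 * h) := ⟨by exact_mod_cast hMpos.ne'⟩
  have hεM : ε * ((2 * h : ℕ) : ℝ) = m / 4 / (L + 1) := by rw [hMR, hε]; field_simp; norm_num
  have hεM' : ε * ((2 * h : ℕ) : ℝ) ≤ m / 4 := by
    rw [hεM]; exact div_le_self (by positivity) (by linarith [(L.cast_nonneg : (0 : ℝ) ≤ L)])
  set a : Fin n → ℤ := fun i => round (α i * ((2 * h : ℕ) : ℝ)) with ha
  have ha1 : ∀ i, |(a i : ℝ) - α i * ((2 * h : ℕ) : ℝ)| ≤ 1 / 2 := by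
    intro i; rw [abs_sub_comm]; exact abs_sub_round _
  have hem : ∀ v ∈ I, |(e v : ℝ)| ≤ m / 4 := by
    intro v hv
    have h1 : (e v).natAbs ≤ ∑ v ∈ I, (e v).natAbs :=
      Finset.single_le_sum (f := fun v => (e v).natAbs) (fun _ _ => Nat.zero_le _) hv
    have h2 : 4 * (e v).natAbs ≤ m := by omega
    have h3 : (4 : ℝ) * ((e v).natAbs : ℝ) ≤ m := by exact_mod_cast h2
    rw [Nat.cast_natAbs, Int.cast_abs] at h3
    linarith
  have hnear : ∀ i : Fin n, ∀ v ∈ I, ∃ z : ℤ, |(e v : ℝ) * a i -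
      (if (i : ℕ) ∈ v then 1 / 2 else 0) * ((2 * h : ℕ) : ℝ) - z * ((2 * h : ℕ) : ℝ)| ≤ m / 2 := by
    intro i v hv
    obtain ⟨z, hz'⟩ := hz i v hv
    refine ⟨z, round_near (ha1 i) (hem v hv) hMpos.le ?_⟩
    exact (mul_le_mul_of_nonneg_right hz' hMpos.le).trans hεM'
  set S := ((I ×ˢ I).filter fun p => Disjoint p.1 p.2).image fun p => e p.1 - e p.2 with hS
  refine ⟨S, ?_, ?_, Fin n → ZMod (2 * h), inferInstance, inferInstance,
    Equiv.addRight fun i => (a i : ZMod (2 * h)), majoritySign m h n r, ?_, ?_, ?_⟩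
  · intro s hs
    simp only [hS, Finset.coe_image, Set.mem_image] at hs
    obtain ⟨p, -, rfl⟩ := hs
    exact Set.sub_mem_sub (heE _) (heE _)
  · intro c
    obtain ⟨v, hv, w, hw, hd, hc⟩ := exists_disjoint_same_colour (n := n) (r := r) hk (by omega)
      (fun v => (c (e v) : ℕ)) (fun v _ => (c (e v)).2)
    refine ⟨e v, e w, Fin.ext hc, ?_⟩
    simp only [hS, Finset.coe_image, Set.mem_image]
    exact ⟨(v, w), by simpa using ⟨⟨hv, hw⟩, hd⟩, rfl⟩
  · intro s hs x
    simp only [hS, Finset.mem_image, Finset.mem_filter, Finset.mem_product] at hs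
    obtain ⟨⟨v, w⟩, ⟨⟨hv, hw⟩, hd⟩, rfl⟩ := hs
    refine majoritySign_mul_ne_one (card_filter_notMem_union hn hv hw hd) fun i hi => ?_
    obtain ⟨z, hz1⟩ := hnear i v hv
    obtain ⟨z', hz2⟩ := hnear i w hw
    have hvw : (i : ℕ) ∈ v ∪ w := by
      simpa only [Finset.mem_filter, Finset.mem_univ, true_and, not_not] using hi
    obtain ⟨y, hy⟩ : ∃ y : ℤ, |(((e v - e w) * a i - y * (2 * h : ℕ) - h : ℤ) : ℝ)| ≤ m := by
      rcases Finset.mem_union.1 hvw with hi | hi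
      · have hi' : (i : ℕ) ∉ w := Finset.disjoint_left.1 hd hi
        rw [if_pos hi] at hz1
        rw [if_neg hi'] at hz2
        refine ⟨z - z', ?_⟩
        push_cast at hz1 hz2 ⊢
        rw [abs_le] at hz1 hz2 ⊢
        constructor <;> linarith [hz1.1, hz1.2, hz2.1, hz2.2]
      · have hi' : (i : ℕ) ∉ v := Finset.disjoint_right.1 hd hi
        rw [if_neg hi'] at hz1
        rw [if_pos hi] at hz2
        -- Here the motion is minus half a turn; the extra -1 adds a full turn.
        refine ⟨z - z' - 1, ?_⟩
        push_cast at hz1 hz2 ⊢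
        rw [abs_le] at hz1 hz2 ⊢
        constructor <;> linarith [hz1.1, hz1.2, hz2.1, hz2.2]
    refine ⟨(e v - e w) * a i - y * (2 * h : ℕ), by exact_mod_cast hy, ?_⟩
    rw [zpow_addRight_apply]
    rw [Pi.add_apply, Pi.smul_apply, zsmul_eq_mul]
    push_cast
    have : ((2 * h : ℕ) : ZMod (2 * h)) = 0 := ZMod.natCast_self _
    push_cast at this
    rw [this, mul_zero, sub_zero]
  · intro s hs x
    refine majoritySign_mul_ne_neg_one fun i => ⟨s * a i, ?_, ?_⟩
    · have hs' : |(s : ℝ)| ≤ L := by exact_mod_cast hs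
      have h1 : |(a i : ℝ)| ≤ m / 4 / (L + 1) + 1 / 2 := by
        have h2 := abs_add_le ((a i : ℝ) - α i * ((2 * h : ℕ) : ℝ)) (α i * ((2 * h : ℕ) : ℝ))
        rw [sub_add_cancel, abs_mul (α i), abs_of_pos hMpos] at h2
        have h3 := mul_le_mul_of_nonneg_right (hα i) hMpos.le
        have := ha1 i
        linarith
      have h2 : |(s : ℝ) * a i| ≤ L * (m / 4 / (L + 1) + 1 / 2) := by
        rw [abs_mul]; gcongr
      have hL0 : (0 : ℝ) ≤ L := L.cast_nonneg
      have h3 : (L : ℝ) * (m / 4 / (L + 1)) ≤ m / 4 := by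
        rw [mul_div_assoc', div_le_iff₀ (by positivity)]
        nlinarith
      have h4 : (2 : ℝ) * L ≤ m := by exact_mod_cast (by omega : 2 * L ≤ m)
      have h5 : |(s : ℝ) * a i| ≤ m := by linarith
      exact_mod_cast h5
    · rw [zpow_addRight_apply]
      simp
  · have hcard : Fintype.card (Fin n → ZMod (2 * h)) = (2 * (m * R)) ^ n := by
      rw [Fintype.card_fun, ZMod.card, Fintype.card_fin, hh]
    rw [hcard, Nat.cast_pow]
    subst hn
    refine (density_estimate hη (by omega) hRn hη0.le hbad).trans ?_
    rw [Nat.cast_le]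
    refine (le_card_majoritySign_ne_zero (h := h) ?_)
    rw [hh, hR]
    simp only [Nat.add_sub_cancel]
    exact le_of_eq (by ring)

/-! ### Sign systems and their products -/

/-- There is a permutation of a finite set with a sign function that is nonzero on a proportion at
least `δ` of the set and never takes the same nonzero sign at two points that differ by a time
in `S`. -/
def HasSignSystem (S : Finset ℤ) (δ : ℝ) : Prop :=
  ∃ (Ω : Type) (_ : Fintype Ω) (_ : Nonempty Ω) (T : Equiv.Perm Ω) (f : Ω → SignType),
    (∀ s ∈ S, ∀ x, f x * f ((T ^ s) x) ≠ 1) ∧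
    δ * Fintype.card Ω ≤ (Finset.univ.filter fun x => f x ≠ 0).card

theorem zpow_prodCongr_apply {α β : Type*} (T : Equiv.Perm α) (T' : Equiv.Perm β) (n : ℤ)
    (x : α × β) :
    ((Equiv.prodCongr T T' : Equiv.Perm (α × β)) ^ n) x = ((T ^ n) x.1, (T' ^ n) x.2) := by
  induction n generalizing x with
  | zero => simp
  | succ n ih =>
    simp only [zpow_add_one, Equiv.Perm.mul_apply, ih, Equiv.prodCongr_apply, Prod.map]
  | pred n ih =>
    have : (Equiv.prodCongr T T' : Equiv.Perm (α × β))⁻¹ x = (T⁻¹ x.1, T'⁻¹ x.2) := rfl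
    simp only [zpow_sub_one, Equiv.Perm.mul_apply, ih, this]

theorem Set.Infinite.exists_residue {E : Set ℤ} (hE : E.Infinite) (N : ℕ) [NeZero N] :
    ∃ c : ZMod N, {x ∈ E | (x : ZMod N) = c}.Infinite := by
  by_contra! h
  refine hE ((Set.finite_iUnion h).subset fun x hx => ?_)
  exact Set.mem_iUnion.2 ⟨(x : ZMod N), hx, rfl⟩

/-- In the product system with the product sign, at each forbidden time one factor cannot keep its
nonzero sign and the other cannot reverse it. Densities multiply, and δ(1 - (δ - δ')) ≥ δ' since δ ≤
1. -/
theorem HasSignSystem.extend {S : Finset ℤ} {δ δ' : ℝ} (h : HasSignSystem S δ) (hδ : δ ≤ 1)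
    (hδ' : 0 ≤ δ') (hlt : δ' < δ) {E : Set ℤ} (hE : E.Infinite) (r : ℕ) :
    ∃ S' : Finset ℤ, (S' : Set ℤ) ⊆ E - E ∧ IsColourRecurrent r S' ∧
      HasSignSystem (S ∪ S') δ' := by
  obtain ⟨Ω, _, _, T, f, hf, hcard⟩ := h
  have hT : 0 < orderOf T := orderOf_pos T
  have : NeZero (orderOf T) := ⟨hT.ne'⟩
  -- Differences within one residue class are multiples of the order of `T`, so the old system
  -- stands still at all new times.
  obtain ⟨c, hc⟩ := hE.exists_residue (orderOf T)
  obtain ⟨S', hS', hrec, Ω', _, _, T', f', hf', hL, hcard'⟩ :=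
    exists_kneser_rotation hc r (∑ s ∈ S, s.natAbs) (η := δ - δ') (by linarith) (by linarith)
  refine ⟨S', hS'.trans (Set.sub_subset_sub (Set.sep_subset _ _) (Set.sep_subset _ _)), hrec,
    Ω × Ω', inferInstance, inferInstance, Equiv.prodCongr T T', fun x => f x.1 * f' x.2, ?_, ?_⟩
  · intro s hs x
    rw [zpow_prodCongr_apply]
    simp only
    rcases Finset.mem_union.1 hs with hs | hs
    · have h1 := hf s hs x.1
      have h2 := hL s (by
        rw [Int.abs_eq_natAbs, Nat.cast_le]
        exact Finset.single_le_sum (f := Int.natAbs) (fun _ _ => Nat.zero_le _) hs) x.2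
      revert h1 h2
      generalize f x.1 = a
      generalize f _ = b
      generalize f' x.2 = c
      generalize f' _ = d
      revert a b c d
      decide
    · have h1 := hf' s hs x.2
      have hT1 : T ^ s = 1 := by
        obtain ⟨a, ha, b, hb, rfl⟩ := hS' hs
        rw [← orderOf_dvd_iff_zpow_eq_one, ← ZMod.intCast_zmod_eq_zero_iff_dvd]
        push_cast
        rw [ha.2, hb.2, sub_self]
      rw [hT1, Equiv.Perm.one_apply]
      revert h1
      generalize f x.1 = a
      generalize f' x.2 = c
      generalize f' _ = d
      revert a c d
      decide
  · have hprod : (Finset.univ.filter fun x : Ω × Ω' => f x.1 * f' x.2 ≠ 0).card =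
        (Finset.univ.filter fun x => f x ≠ 0).card *
          (Finset.univ.filter fun x => f' x ≠ 0).card := by
      rw [← Finset.card_product]
      congr 1
      ext x
      simp
    rw [hprod, Fintype.card_prod]
    push_cast
    have h0 : (0 : ℝ) ≤ Fintype.card Ω := Nat.cast_nonneg _
    have h0' : (0 : ℝ) ≤ Fintype.card Ω' := Nat.cast_nonneg _
    have hm := mul_le_mul hcard hcard' (mul_nonneg (by linarith) h0') (Nat.cast_nonneg _)
    refine le_trans ?_ hm
    have hδδ : δ' ≤ δ * (1 - (δ - δ')) := by nlinarith
    calc δ' * (Fintype.card Ω * Fintype.card Ω')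
        ≤ (δ * (1 - (δ - δ'))) * (Fintype.card Ω * Fintype.card Ω' : ℝ) := by gcongr
      _ = _ := by ring

theorem hasSignSystem_empty : HasSignSystem ∅ 1 :=
  ⟨Unit, inferInstance, inferInstance, 1, fun _ => 1, by simp, by simp⟩

theorem HasSignSystem.mono {S S' : Finset ℤ} {δ δ' : ℝ} (h : HasSignSystem S δ) (hS : S' ⊆ S)
    (hδ : δ' ≤ δ) : HasSignSystem S' δ' := by
  obtain ⟨Ω, i, i', T, f, hf, hcard⟩ := h
  exact ⟨Ω, i, i', T, f, fun s hs => hf s (hS hs), le_trans (by gcongr) hcard⟩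

/-- Every difference set contains a set that is recurrent for all finite colourings but all of
whose finite subsets have sign systems of density `1 / 2`. -/
theorem exists_colourRecurrent_hasSignSystem {E : Set ℤ} (hE : E.Infinite) :
    ∃ S : Set ℤ, S ⊆ E - E ∧ (∀ r, IsColourRecurrent r S) ∧
      ∀ F : Finset ℤ, (F : Set ℤ) ⊆ S → HasSignSystem F (1 / 2) := by
  -- The densities 1/2 + 2^-(r + 1) start at 1, where the empty system applies, and never fall below
  -- 1/2.
  have hstep : ∀ (r : ℕ) (S : Finset ℤ), HasSignSystem S (1 / 2 + 1 / 2 ^ (r + 1)) →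
      ∃ S' : Finset ℤ, (S' : Set ℤ) ⊆ E - E ∧ IsColourRecurrent r S' ∧
        HasSignSystem (S ∪ S') (1 / 2 + 1 / 2 ^ (r + 2)) := by
    intro r S hS
    have h2 : (1 : ℝ) / 2 ^ (r + 1) ≤ 1 / 2 := by
      rw [div_le_div_iff₀ (by positivity) (by norm_num), pow_succ]
      have : (1 : ℝ) ≤ 2 ^ r := one_le_pow₀ (by norm_num)
      linarith
    refine hS.extend (by linarith) (by positivity) ?_ hE r
    have : (1 : ℝ) / 2 ^ (r + 2) < 1 / 2 ^ (r + 1) := by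
      apply one_div_lt_one_div_of_lt (by positivity)
      exact pow_lt_pow_right₀ (by norm_num) (by omega)
    linarith
  choose! next hsub hrec hsys using hstep
  let u : ℕ → Finset ℤ := fun r => Nat.rec ∅ (fun r S => S ∪ next r S) r
  have hu : ∀ r, HasSignSystem (u r) (1 / 2 + 1 / 2 ^ (r + 1)) := by
    intro r
    induction r with
    | zero => norm_num; exact hasSignSystem_empty
    | succ r ih => exact hsys r _ ih
  have hmono : Monotone u := monotone_nat_of_le_succ fun r => Finset.subset_union_left
  refine ⟨⋃ r, (next r (u r) : Set ℤ), Set.iUnion_subset fun r => hsub r _ (hu r), ?_, ?_⟩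
  · intro r c
    obtain ⟨a, b, hab, hS⟩ := hrec r _ (hu r) c
    exact ⟨a, b, hab, Set.mem_iUnion.2 ⟨r, hS⟩⟩
  · intro F hF
    have : ∃ R, F ⊆ u R := by
      induction F using Finset.induction with
      | empty => exact ⟨0, Finset.empty_subset _⟩
      | insert a F _ ih =>
        rw [Finset.coe_insert, Set.insert_subset_iff] at hF
        obtain ⟨R, hR⟩ := ih hF.2
        obtain ⟨r, hr⟩ := Set.mem_iUnion.1 hF.1
        refine ⟨max R (r + 1), Finset.insert_subset ?_ (hR.trans (hmono (le_max_left _ _)))⟩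
        exact hmono (le_max_right R (r + 1)) (Finset.subset_union_right (s₁ := u r) hr)
    obtain ⟨R, hR⟩ := this
    exact (hu R).mono hR (by linarith [show (0 : ℝ) < 1 / 2 ^ (R + 1) by positivity])

/-! ### Furstenberg's correspondence by compactness -/

/-- The shift on two-sided sequences of bits. -/
def bitShift : (ℤ → Bool) ≃ₜ (ℤ → Bool) where
  toFun x i := x (i + 1)
  invFun x i := x (i - 1)
  left_inv x := by ext i; simp
  right_inv x := by ext i; simp
  continuous_toFun := by fun_prop
  continuous_invFun := by fun_prop

theorem bitShift_zpow_apply (n : ℤ) (x : ℤ → Bool) (i : ℤ) :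
    ((bitShift.toMeasurableEquiv.toEquiv : Equiv.Perm (ℤ → Bool)) ^ n) x i = x (i + n) := by
  induction n generalizing x with
  | zero => simp
  | succ n ih =>
    rw [zpow_add_one, Equiv.Perm.mul_apply, ih]
    show x (i + n + 1) = _
    rw [add_assoc]
  | pred n ih =>
    rw [zpow_sub_one, Equiv.Perm.mul_apply, ih]
    show x (i + -n - 1) = _
    congr 1
    ring

section Correspondence

open MeasureTheory

/-- The cylinder of sequences with a `1` at the origin. -/
def originCylinder : Set (ℤ → Bool) := {x | x 0 = true}

/-- The cylinder of sequences with a `1` at the origin and at `s`. -/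
def pairCylinder (s : ℤ) : Set (ℤ → Bool) := {x | x 0 = true ∧ x s = true}

theorem isClopen_originCylinder : IsClopen originCylinder :=
  (isClopen_discrete {true}).preimage (continuous_apply (0 : ℤ))

theorem isClopen_pairCylinder (s : ℤ) : IsClopen (pairCylinder s) :=
  isClopen_originCylinder.inter ((isClopen_discrete {true}).preimage (continuous_apply s))

/-- Shift-invariant probability measures with `μ (x₀ = 1) ≥ 1 / 4`, and `μ (x₀ = xₛ = 1) = 0` in
case `s ∈ S`. -/
def avoidingMeasures (S : Set ℤ) (s : ℤ) : Set (ProbabilityMeasure (ℤ → Bool)) :=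
  {μ | μ.map bitShift.continuous.measurable.aemeasurable = μ ∧ 1 / 4 ≤ μ originCylinder ∧
    (s ∈ S → μ (pairCylinder s) = 0)}

theorem continuous_apply_of_isClopen {A : Set (ℤ → Bool)} (hA : IsClopen A) :
    Continuous fun μ : ProbabilityMeasure (ℤ → Bool) => μ A :=
  continuous_iff_continuousAt.2 fun _ =>
    ProbabilityMeasure.tendsto_measure_of_isClopen_of_tendsto Filter.tendsto_id hA

theorem isClosed_avoidingMeasures (S : Set ℤ) (s : ℤ) : IsClosed (avoidingMeasures S s) := by
  refine (isClosed_eq (ProbabilityMeasure.continuous_map bitShift.continuous) continuous_id).inter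
    ((isClosed_le continuous_const (continuous_apply_of_isClopen isClopen_originCylinder)).inter ?_)
  by_cases hs : s ∈ S
  · simp only [hs, true_imp_iff]
    exact isClosed_eq (continuous_apply_of_isClopen (isClopen_pairCylinder s)) continuous_const
  · simp only [hs, false_imp_iff]
    exact isClosed_const

theorem map_uniformOn_univ {Ω : Type*} [Fintype Ω] [MeasurableSpace Ω]
    [DiscreteMeasurableSpace Ω] (T : Equiv.Perm Ω) :
    (ProbabilityTheory.uniformOn (Set.univ : Set Ω)).map T = ProbabilityTheory.uniformOn Set.univ := by
  ext A _
  rw [Measure.map_apply (measurable_of_finite T) (MeasurableSet.of_discrete),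
    ProbabilityTheory.uniformOn_univ, ProbabilityTheory.uniformOn_univ,
    Measure.count_apply MeasurableSet.of_discrete, Measure.count_apply MeasurableSet.of_discrete,
    Set.encard_preimage_of_bijective T.bijective]

/-- Record along each orbit the visits to the points of the commoner sign and push the uniform
measure forward. That sign has density at least 1/4, and two visits at distance s in `F` would give
equal nonzero signs. -/
theorem HasSignSystem.exists_measure {S : Set ℤ} {F : Finset ℤ} (I : Finset ℤ)
    (hI : ∀ s ∈ I, s ∈ S → s ∈ F) (h : HasSignSystem F (1 / 2)) :
    (⋂ s ∈ I, avoidingMeasures S s).Nonempty := by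
  classical
  obtain ⟨Ω, _, _, T, f, hf, hcard⟩ := h
  obtain ⟨σ, hσ, hσcard⟩ : ∃ σ : SignType, σ * σ = 1 ∧
      Fintype.card Ω ≤ 4 * (Finset.univ.filter fun x => f x = σ).card := by
    have h1 : (Finset.univ.filter fun x => f x ≠ 0) ⊆
        (Finset.univ.filter fun x => f x = 1) ∪ (Finset.univ.filter fun x => f x = -1) := by
      intro x
      simp only [Finset.mem_filter, Finset.mem_univ, true_and, Finset.mem_union]
      generalize f x = a
      revert a
      decide
    have h2 := (Finset.card_le_card h1).trans (Finset.card_union_le _ _)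
    have h3 : Fintype.card Ω ≤ 2 * (Finset.univ.filter fun x => f x ≠ 0).card := by
      have : (Fintype.card Ω : ℝ) ≤ 2 * (Finset.univ.filter fun x => f x ≠ 0).card := by linarith
      exact_mod_cast this
    rcases le_total (Finset.univ.filter fun x => f x = 1).card
      (Finset.univ.filter fun x => f x = -1).card with h | h
    · exact ⟨-1, by decide, by omega⟩
    · exact ⟨1, by decide, by omega⟩
  let _ : MeasurableSpace Ω := ⊤
  set φ : Ω → ℤ → Bool := fun x n => decide (f ((T ^ n) x) = σ) with hφ
  have hφm : Measurable φ := measurable_of_finite φ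
  let ν : ProbabilityMeasure Ω := ⟨ProbabilityTheory.uniformOn Set.univ, inferInstance⟩
  refine ⟨ν.map hφm.aemeasurable, Set.mem_iInter₂.2 fun s hs => ⟨?_, ?_, fun hsS => ?_⟩⟩
  · apply Subtype.ext
    show Measure.map bitShift (Measure.map φ (ProbabilityTheory.uniformOn Set.univ)) =
      Measure.map φ (ProbabilityTheory.uniformOn Set.univ)
    rw [Measure.map_map bitShift.continuous.measurable hφm]
    have : bitShift ∘ φ = φ ∘ T := by
      ext x i
      show decide (f ((T ^ (i + 1)) x) = σ) = decide (f ((T ^ i) (T x)) = σ)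
      rw [zpow_add_one, Equiv.Perm.mul_apply]
    rw [this, ← Measure.map_map hφm (measurable_of_finite T), map_uniformOn_univ]
  · rw [ProbabilityMeasure.map_apply _ _ isClopen_originCylinder.isOpen.measurableSet,
      ← ENNReal.coe_le_coe, ProbabilityMeasure.ennreal_coeFn_eq_coeFn_toMeasure]
    have : φ ⁻¹' originCylinder = ((Finset.univ.filter fun x => f x = σ : Finset Ω) : Set Ω) := by
      ext x; simp [hφ, originCylinder]
    rw [this]
    show _ ≤ ProbabilityTheory.uniformOn Set.univ _
    rw [ProbabilityTheory.uniformOn_univ, Measure.count_apply_finset,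
      ENNReal.le_div_iff_mul_le (Or.inl (by simp)) (Or.inl (by simp))]
    have h4 : (Fintype.card Ω : ENNReal) ≤ 4 * (Finset.univ.filter fun x => f x = σ).card := by
      exact_mod_cast hσcard
    rw [ENNReal.coe_div (by norm_num), ENNReal.coe_one, one_div]
    push_cast
    rwa [ENNReal.inv_mul_le_iff (by norm_num) (by norm_num)]
  · rw [ProbabilityMeasure.map_apply _ _ (isClopen_pairCylinder s).isOpen.measurableSet]
    have : φ ⁻¹' pairCylinder s = ∅ := by
      refine Set.eq_empty_of_forall_notMem fun x hx => ?_
      simp only [hφ, pairCylinder, Set.mem_preimage, Set.mem_ofPred_eq, decide_eq_true_eq, zpow_zero,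
        Equiv.Perm.one_apply] at hx
      apply hf s (hI s hs hsS) x
      rw [hx.1, hx.2, hσ]
    rw [this]
    simp

/-- A set of times that admits, for all its finite subsets, sign systems of density `1 / 2` is not a
set of measurable recurrence (Furstenberg's correspondence). -/
theorem not_isMeasurablyRecurrent_of_hasSignSystem {S : Set ℤ}
    (h : ∀ F : Finset ℤ, (F : Set ℤ) ⊆ S → HasSignSystem F (1 / 2)) :
    ¬ IsMeasurablyRecurrent S := by
  classical
  intro hrec
  obtain ⟨μ, hμ⟩ := CompactSpace.iInter_nonempty (isClosed_avoidingMeasures S) fun I =>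
    HasSignSystem.exists_measure (S := S) (F := I.filter (· ∈ S))
      I (fun s hs hsS => Finset.mem_filter.2 ⟨hs, hsS⟩)
      (h _ fun s hs => (Finset.mem_filter.1 hs).2)
  rw [Set.mem_iInter] at hμ
  -- Invariance and the lower bound are part of the condition at every index, so index 0 serves
  -- whether or not it lies in `S`.
  have hinv : MeasurePreserving bitShift.toMeasurableEquiv (μ : Measure (ℤ → Bool)) μ := by
    refine ⟨bitShift.continuous.measurable, ?_⟩
    exact congrArg Subtype.val (hμ 0).1
  have hpos : 0 < (μ : Measure (ℤ → Bool)) originCylinder := by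
    rw [← ProbabilityMeasure.ennreal_coeFn_eq_coeFn_toMeasure]
    exact ENNReal.coe_pos.2 (lt_of_lt_of_le (by norm_num) (hμ 0).2.1)
  obtain ⟨s, hs, hlt⟩ := hrec _ (μ : Measure (ℤ → Bool)) bitShift.toMeasurableEquiv hinv
    originCylinder isClopen_originCylinder.isOpen.measurableSet hpos
  have heq : originCylinder ∩
      ⇑((bitShift.toMeasurableEquiv.toEquiv : Equiv.Perm (ℤ → Bool)) ^ s) ⁻¹' originCylinder =
      pairCylinder s := by
    ext x
    simp only [originCylinder, pairCylinder, Set.mem_inter_iff, Set.mem_preimage, Set.mem_ofPred_eq]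
    rw [bitShift_zpow_apply, zero_add]
  rw [heq, ← ProbabilityMeasure.ennreal_coeFn_eq_coeFn_toMeasure, (hμ s).2.2 hs] at hlt
  simp at hlt

end Correspondence

/-! ### Passing between the notions of recurrence -/

theorem isChromaticallyRecurrent_of_forall {S : Set ℤ} (h : ∀ r, IsColourRecurrent r S) :
    IsChromaticallyRecurrent S := by
  intro r A _ hA
  choose c hc using fun x : ℤ => Set.mem_iUnion.1 (hA.symm ▸ Set.mem_univ x : x ∈ ⋃ j, A j)
  obtain ⟨a, b, hab, hS⟩ := h r c
  exact ⟨c a, a - b, Set.sub_mem_sub (hc a) (hab ▸ hc b), hS⟩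

/-- By minimality and compactness finitely many preimages T⁻ⁿU cover the space. Colouring m by such
an n for T^m x₀ gives two times a, b with one n, and a - b carries a point of `U` into `U`. -/
theorem isTopologicallyRecurrent_of_forall {S : Set ℤ} (h : ∀ r, IsColourRecurrent r S) :
    IsTopologicallyRecurrent S := by
  intro X _ _ _ T hT U hU hne
  obtain ⟨x₀, hx₀⟩ := hne
  obtain ⟨t, ht⟩ := isCompact_univ.elim_finite_subcover (fun n : ℤ => ⇑(T ^ n) ⁻¹' U)
    (fun n => hU.preimage (T ^ n).continuous) (fun x _ => by
      obtain ⟨_, hy, n, rfl⟩ := (hT x).inter_open_nonempty U hU ⟨x₀, hx₀⟩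
      exact Set.mem_iUnion.2 ⟨n, hy⟩)
  have hc : ∀ m : ℤ, ∃ j : t, (T ^ (j : ℤ)) ((T ^ m) x₀) ∈ U := by
    intro m
    obtain ⟨n, hn, hm⟩ := Set.mem_iUnion₂.1 (ht (Set.mem_univ ((T ^ m) x₀)))
    exact ⟨⟨n, hn⟩, hm⟩
  choose c hc using hc
  obtain ⟨a, b, hab, hS⟩ := h (Fintype.card t) fun m => Fintype.equivFin t (c m)
  have hab' : c a = c b := (Fintype.equivFin t).injective hab
  refine ⟨a - b, hS, (T ^ (c b : ℤ)) ((T ^ b) x₀), hc b, ?_⟩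
  have ha := hc a
  rw [hab'] at ha
  have : (T ^ (a - b)) ((T ^ (c b : ℤ)) ((T ^ b) x₀)) = (T ^ (c b : ℤ)) ((T ^ a) x₀) := by
    rw [← Homeomorph.mul_apply, ← Homeomorph.mul_apply, ← Homeomorph.mul_apply, ← zpow_add,
      ← zpow_add, ← zpow_add]
    congr 2
    ring
  rw [Set.mem_preimage, this]
  exact ha

section Density

open MeasureTheory Filter Topology

theorem MeasurableEquiv.measurable_toEquiv_zpow {X : Type*} [MeasurableSpace X] (T : X ≃ᵐ X)
    (n : ℤ) : Measurable ⇑((T.toEquiv : Equiv.Perm X) ^ n) := by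
  induction n with
  | zero => exact measurable_id
  | succ n ih =>
    rw [zpow_add_one, Equiv.Perm.coe_mul]
    exact ih.comp T.measurable
  | pred n ih =>
    rw [zpow_sub_one, Equiv.Perm.coe_mul]
    exact ih.comp T.symm.measurable

/-- A point of a measure preserving system whose visits to a given set of positive measure have
positive upper density. -/
theorem exists_upperDensity_pos {X : Type*} [MeasurableSpace X] (μ : Measure X)
    [IsProbabilityMeasure μ] (T : X ≃ᵐ X) (hT : MeasurePreserving T μ μ) {B : Set X}
    (hB : MeasurableSet B) (hpos : 0 < μ B) :
    ∃ x, 0 < upperDensity {n : ℤ | ((T.toEquiv : Equiv.Perm X) ^ n) x ∈ B} := by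
  classical
  -- Otherwise the visit frequencies `F N` tend to 0 everywhere, hence in mean by dominated
  -- convergence, although each has integral μ(B) for N ≥ 1.
  by_contra! hcon
  set F : ℕ → X → ℝ := fun N x =>
    (∑ i ∈ Finset.Icc 1 N, ((⇑T)^[i] ⁻¹' B).indicator (fun _ => (1 : ℝ)) x) / N with hF
  have hFeq : ∀ (N : ℕ) x, ((({n : ℤ | ((T.toEquiv : Equiv.Perm X) ^ n) x ∈ B} ∩
      Set.Icc 1 (N : ℤ)).ncard : ℝ) / N) = F N x := by
    intro N x
    have hset : {n : ℤ | ((T.toEquiv : Equiv.Perm X) ^ n) x ∈ B} ∩ Set.Icc 1 (N : ℤ) =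
        (((Finset.Icc 1 N).filter fun i => (⇑T)^[i] x ∈ B).image (Nat.cast : ℕ → ℤ) : Finset ℤ) := by
      ext n
      simp only [Set.mem_inter_iff, Set.mem_ofPred_eq, Set.mem_Icc, Finset.coe_image,
        Finset.coe_filter, Finset.mem_Icc, Set.mem_image]
      have hiter : ∀ i : ℕ, ((T.toEquiv : Equiv.Perm X) ^ i) x = (⇑T)^[i] x := by
        intro i
        rw [Equiv.Perm.coe_pow]
        rfl
      constructor
      · rintro ⟨hn, h1, h2⟩
        lift n to ℕ using by omega
        rw [zpow_natCast, hiter] at hn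
        exact ⟨n, ⟨⟨by omega, by omega⟩, hn⟩, rfl⟩
      · rintro ⟨i, ⟨⟨h1, h2⟩, hi⟩, rfl⟩
        rw [zpow_natCast, hiter]
        exact ⟨hi, by omega, by omega⟩
    rw [hset, Set.ncard_coe_finset, Finset.card_image_of_injective _ Nat.cast_injective,
      Finset.card_filter, hF]
    push_cast
    simp only [Set.indicator_apply, Set.mem_preimage]
  have hF0 : ∀ N x, 0 ≤ F N x := by
    intro N x
    rw [← hFeq]; positivity
  have hF1 : ∀ N x, F N x ≤ 1 := by
    intro N x
    apply div_le_one_of_le₀ _ (Nat.cast_nonneg _)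
    calc _ ≤ ∑ i ∈ Finset.Icc 1 N, (1 : ℝ) := Finset.sum_le_sum fun i _ => by
          rw [Set.indicator_apply]; split_ifs <;> norm_num
      _ = N := by simp
  have hlim : ∀ x, Tendsto (fun N => F N x) atTop (𝓝 0) := by
    intro x
    have hb : IsBoundedUnder (· ≤ ·) atTop (fun N => F N x) :=
      isBoundedUnder_of ⟨1, fun N => hF1 N x⟩
    have hb' : IsBoundedUnder (· ≥ ·) atTop (fun N => F N x) :=
      isBoundedUnder_of ⟨0, fun N => hF0 N x⟩
    refine tendsto_of_le_liminf_of_limsup_le ?_ ?_ hb hb'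
    · exact le_liminf_of_le hb.isCoboundedUnder_ge (Eventually.of_forall fun N => hF0 N x)
    · have := hcon x
      rw [upperDensity] at this
      simpa only [hFeq] using this
  have hmeas : ∀ i : ℕ, MeasurableSet ((⇑T)^[i] ⁻¹' B) := fun i => T.measurable.iterate i hB
  have hint : ∀ N, 1 ≤ N → ∫ x, F N x ∂μ = μ.real B := by
    intro N hN
    simp only [hF]
    rw [integral_div, integral_finsetSum]
    · have : ∀ i ∈ Finset.Icc 1 N,
          ∫ x, ((⇑T)^[i] ⁻¹' B).indicator (fun _ => (1 : ℝ)) x ∂μ = μ.real B := by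
        intro i _
        rw [integral_indicator_const _ (hmeas i), smul_eq_mul, mul_one,
          measureReal_def, (hT.iterate i).measure_preimage hB.nullMeasurableSet, measureReal_def]
      rw [Finset.sum_congr rfl this]
      have : (N : ℝ) ≠ 0 := by exact_mod_cast (by omega : N ≠ 0)
      simp only [Finset.sum_const, Nat.card_Icc, Nat.add_sub_cancel, nsmul_eq_mul]
      field_simp
    · intro i _
      exact (integrable_const (1 : ℝ)).indicator (hmeas i)
  have h1 : Tendsto (fun N => ∫ x, F N x ∂μ) atTop (𝓝 (∫ _, (0 : ℝ) ∂μ)) := by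
    refine tendsto_integral_of_dominated_convergence (fun _ => (1 : ℝ)) (fun N => ?_)
      (integrable_const _) (fun N => ae_of_all _ fun x => ?_) (ae_of_all _ hlim)
    · refine Measurable.aestronglyMeasurable ?_
      refine Measurable.div_const (Finset.measurable_sum _ fun i _ => ?_) _
      exact measurable_const.indicator (hmeas i)
    · rw [Real.norm_of_nonneg (hF0 N x)]
      exact hF1 N x
  have h2 : Tendsto (fun N => ∫ x, F N x ∂μ) atTop (𝓝 (μ.real B)) :=
    tendsto_const_nhds.congr' ((eventually_ge_atTop 1).mono fun N hN => (hint N hN).symm)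
  have h3 := tendsto_nhds_unique h2 h1
  rw [integral_zero, measureReal_def, ENNReal.toReal_eq_zero_iff] at h3
  rcases h3 with h3 | h3
  · exact hpos.ne' h3
  · exact measure_ne_top μ B h3

theorem IsDensityRecurrent.isMeasurablyRecurrent {S : Set ℤ} (h : IsDensityRecurrent S) :
    IsMeasurablyRecurrent S := by
  intro X _ μ _ T hT B hB hpos
  by_contra! hcon
  -- Removing these null sets makes every return at a time in `S` impossible, not just negligible,
  -- so a single orbit yields the contradiction.
  set N := ⋃ n ∈ S, B ∩ ⇑((T.toEquiv : Equiv.Perm X) ^ n) ⁻¹' B with hN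
  have hNm : MeasurableSet N := MeasurableSet.biUnion S.to_countable fun n _ =>
    hB.inter (T.measurable_toEquiv_zpow n hB)
  have hN0 : μ N = 0 := (measure_biUnion_null_iff S.to_countable).2 fun n hn =>
    le_antisymm (hcon n hn) bot_le
  obtain ⟨x, hx⟩ := exists_upperDensity_pos μ T hT (hB.diff hNm)
    (by rwa [measure_sdiff_null hN0])
  obtain ⟨_, ⟨a, ha, b, hb, rfl⟩, hS⟩ := h _ hx
  refine hb.2 (Set.mem_iUnion₂.2 ⟨a - b, hS, hb.1, ?_⟩)
  rw [Set.mem_preimage, ← Equiv.Perm.mul_apply, ← zpow_add, sub_add_cancel]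
  exact ha.1

end Density

theorem theorem2 (E : Set ℤ) (hE : E.Infinite) :
    ∃ S : Set ℤ, S ⊆ E - E ∧
      (IsChromaticallyRecurrent S ∧ ¬ IsDensityRecurrent S) ∧
      (IsTopologicallyRecurrent S ∧ ¬ IsMeasurablyRecurrent S) := by
  obtain ⟨S, hSE, hcol, hsys⟩ := exists_colourRecurrent_hasSignSystem hE
  have hmeas := not_isMeasurablyRecurrent_of_hasSignSystem hsys
  exact ⟨S, hSE, ⟨isChromaticallyRecurrent_of_forall hcol, fun h => hmeas h.isMeasurablyRecurrent⟩,
    isTopologicallyRecurrent_of_forall hcol, hmeas⟩
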